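/- Let $\tau\in\mathbb C\setminus\mathbb R$ and let $E=\mathbb C/\langle 1,\tau\rangle$, an elliptic curve whose rational functions are the meromorphic functions on $\mathbb C$ that are periodic under $\langle 1,\tau\rangle$. Let $D(z)=\operatorname{Im}\mathrm{Li}_2(z)+\arg(1-z)\ln|z|$ be the Bloch–Wigner dilogarithm and $D_\tau(\xi)=\sum_{n\in\mathbb Z}D(e^{2\pi i\xi+2\pi i\tau n})$ the elliptic dilogarithm on $E$. Consider the following relations between values of $D_\tau$. (1) Antisymmetry relations: $D_\tau(\xi)+D_\tau(-\xi)=0$ for $\xi\in E$. (2) Elliptic Bloch relations: if $f$ is a rational function on $E$, different from the constants $0$ and $1$, of degree $n$ (it has $n$ zeros counted with multiplicity), with divisors $(f)=\sum_{i=1}^n([\alpha_i]-[\gamma_i])$ and $(1-f)=\sum_{i=1}^n([\beta_i]-[\gamma_i])$, the relation $$\sum_{i,j=1}^n\bigl(D_\tau(\alpha_i-\beta_j)+D_\tau(\beta_i-\gamma_j)+D_\tau(\gamma_i-\alpha_j)\bigr)=0 .$$ (3) Relations of concurrent lines: realize $E$ as a plane cubic by $z\mapsto[\wp(z):\wp'(z):1]$,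 let $l,m,n\subset\mathbb P^2(\mathbb C)$ be three different lines through a common point that does not lie on the cubic, with homogeneous equations normalised by $h_m=h_n+h_l$, and let $\alpha_i,\beta_i,\gamma_i$ ($i=1,2,3$) be the intersection points, with multiplicity, of $l,n,m$ respectively with $E$; the relation is $$\sum_{i,j=1}^3\bigl(D_\tau(\alpha_i-\beta_j)+D_\tau(\beta_i-\gamma_j)+D_\tau(\gamma_i-\alpha_j)\bigr)=0 .$$ Theorem. For every rational function $f\ne 0,1$ on $E$ the relation (2) is a linear combination with integer coefficients of relations of the form (1) and (3). This holds formally: in the free abelian group $\mathbb Z[E]$ on the points of $E$, the element $\sum_{i,j}([\alpha_i-\beta_j]+[\beta_i-\gamma_j]+[\gamma_i-\alpha_j])$ attached to $f$ is an integer linear combination of elements $[\xi]+[-\xi]$ and of elements of the same shape attached to triples of lines as in (3); consequently the left-hand side of (2) is the corresponding integer linear combination of the left-hand sides of (1) and (3). -/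

import Mathlib

open scoped BigOperators

noncomputable section

namespace EllipticDilog

/-! ### The elliptic curve `E = ℂ / ⟨1, τ⟩` and its rational functions -/

/-- The pair of periods `1, τ` of a non-real complex number `τ`. -/
def periods (τ : ℂ) (hτ : τ.im ≠ 0) : PeriodPair where
  ω₁ := 1
  ω₂ := τ
  indep := by
    rw [LinearIndependent.pair_iff]
    intro s t h
    have him := congrArg Complex.im h
    have hre := congrArg Complex.re h
    simp at him hre
    have ht : t = 0 := him.resolve_right hτ
    subst ht
    simpa using hre

/-- The elliptic curve `ℂ / Λ` attached to a pair of periods, as a group. -/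
abbrev Curve (L : PeriodPair) : Type := ℂ ⧸ L.lattice

/-- The point of `ℂ / Λ` represented by a complex number. -/
def pt (L : PeriodPair) (z : ℂ) : Curve L := Submodule.Quotient.mk z

/-- The group `ℤ[E]` of finite formal integer combinations of points of `E = ℂ / Λ`.  It is used
both for divisors and for formal relations. -/
abbrev PointGroup (L : PeriodPair) : Type := Curve L →₀ ℤ

/-- The generator `[p]` of `ℤ[E]`. -/
def cls {L : PeriodPair} (p : Curve L) : PointGroup L := Finsupp.single p 1

/-- Rational functions on `E = ℂ / Λ`, seen as elliptic functions on `ℂ`: meromorphic functions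
on the plane which are `Λ`-periodic. -/
def IsRationalFunction (L : PeriodPair) (f : ℂ → ℂ) : Prop :=
  Meromorphic f ∧ ∀ l ∈ L.lattice, Function.Periodic f l

/-- The element `D` of `ℤ[E]` is the divisor of the elliptic function `f`.  All orders being finite,
this forces `f` to be different from the zero function. -/
def HasDivisor {L : PeriodPair} (f : ℂ → ℂ) (D : PointGroup L) : Prop :=
  ∀ z : ℂ, meromorphicOrderAt f z = ((D (pt L z) : ℤ) : WithTop ℤ)

/-- The (non-zero) elliptic function `f` has degree `n`: it has `n` zeros on `ℂ / Λ`, counted with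
multiplicity. -/
def HasDegree (L : PeriodPair) (f : ℂ → ℂ) (n : ℕ) : Prop :=
  ∃ D : PointGroup L, HasDivisor f D ∧ (D.sum fun _ m => max m 0) = (n : ℤ)

/-! ### The elliptic dilogarithm -/

/-- The principal branch of the dilogarithm, `Li₂(z) = -∫₀¹ log (1 - t z) dt / t`. -/
def Li2 (z : ℂ) : ℂ := -∫ t in (0 : ℝ)..1, Complex.log (1 - (t : ℂ) * z) / (t : ℂ)

/-- The Bloch-Wigner dilogarithm `D(z) = Im Li₂(z) + arg(1 - z) ln |z|`. -/
def blochWigner (z : ℂ) : ℝ := (Li2 z).im + Complex.arg (1 - z) * Real.log ‖z‖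

/-- The series `∑ₙ D(exp (2πiξ + 2πiτn))` over all integers `n`, as a function of `ξ ∈ ℂ`. -/
def ellDilogSeries (τ ξ : ℂ) : ℝ :=
  ∑' n : ℤ, blochWigner
    (Complex.exp (2 * Real.pi * Complex.I * ξ + 2 * Real.pi * Complex.I * τ * n))

theorem ellDilogSeries_add (τ ξ : ℂ) (a b : ℤ) :
    ellDilogSeries τ (ξ + (a * 1 + b * τ)) = ellDilogSeries τ ξ := by
  unfold ellDilogSeries
  rw [← (Equiv.addRight b).tsum_eq (fun n : ℤ => blochWigner
    (Complex.exp (2 * Real.pi * Complex.I * ξ + 2 * Real.pi * Complex.I * τ * n)))]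
  refine tsum_congr fun n => congrArg blochWigner ?_
  rw [Complex.exp_eq_exp_iff_exists_int]
  refine ⟨a, ?_⟩
  simp only [Equiv.coe_addRight]
  push_cast
  ring

/-- The elliptic dilogarithm `D_τ : ℂ / ⟨1, τ⟩ → ℝ`. -/
def ellDilog (τ : ℂ) (hτ : τ.im ≠ 0) (p : Curve (periods τ hτ)) : ℝ :=
  Quotient.liftOn' p (ellDilogSeries τ) (by
    intro x y h
    rw [Submodule.quotientRel_def, PeriodPair.mem_lattice] at h
    obtain ⟨a, b, hab⟩ := h
    have hx : x = y + (a * 1 + b * τ) := by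
      have h' : (a : ℂ) * 1 + b * τ = x - y := hab
      rw [h']; ring
    rw [hx, ellDilogSeries_add])

/-! ### The plane cubic model and lines -/

/-- Homogeneous coordinates of the image of `z` under the embedding of `ℂ / Λ` as the plane cubic
`Y² Z = 4 X³ - g₂ X Z² - g₃ Z³`: the point `[℘(z) : ℘'(z) : 1]`, and `[0 : 1 : 0]` for `z ∈ Λ`. -/
def cubicPoint (L : PeriodPair) (z : ℂ) : Fin 3 → ℂ :=
  open Classical in
  if z ∈ L.lattice then ![0, 1, 0] else ![L.weierstrassP z, L.derivWeierstrassP z, 1]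

/-- A lift of the embedding of `ℂ / Λ` to homogeneous coordinates near `z₀`.  Up to removable
singularities it is holomorphic near `z₀`, with a value at `z₀` that is a non-zero multiple of
`cubicPoint L z₀`. -/
def cubicLift (L : PeriodPair) (z₀ w : ℂ) : Fin 3 → ℂ :=
  open Classical in
  (if z₀ ∈ L.lattice then (w - z₀) ^ 3 else 1) •
    ![L.weierstrassP w, L.derivWeierstrassP w, 1]

/-- The multiplicity with which the line `h₀ X + h₁ Y + h₂ Z = 0` meets the cubic at the image
of `z₀`: the order of vanishing of the equation of the line along the curve. -/
def lineMultiplicity (L : PeriodPair) (h : Fin 3 → ℂ) (z₀ : ℂ) : WithTop ℤ :=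
  meromorphicOrderAt (fun w => h ⬝ᵥ cubicLift L z₀ w) z₀

/-- The points `p 0, p 1, p 2` of `E` are the three intersection points, with multiplicity, of the
line with equation `h` and the cubic. -/
def IsLineSection {L : PeriodPair} (h : Fin 3 → ℂ) (p : Fin 3 → Curve L) : Prop :=
  ∀ z : ℂ, lineMultiplicity L h z = (((∑ i, cls (p i)) (pt L z) : ℤ) : WithTop ℤ)

/-- `α`, `β`, `γ` are the intersection points with the cubic of the lines `l`, `n`, `m`, where
`l`, `m`, `n` are three different lines through a common point `P` of the plane that is not on
the cubic, with homogeneous equations `hl`, `hm`, `hn` normalised by `hm = hn + hl`. -/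
def IsConcurrentSection {L : PeriodPair} (α β γ : Fin 3 → Curve L) : Prop :=
  ∃ hl hm hn : Fin 3 → ℂ,
    (LinearIndependent ℂ ![hl, hm] ∧ LinearIndependent ℂ ![hm, hn] ∧
      LinearIndependent ℂ ![hl, hn]) ∧
    hm = hn + hl ∧
    (∃ P : Fin 3 → ℂ, P ≠ 0 ∧ hl ⬝ᵥ P = 0 ∧ hm ⬝ᵥ P = 0 ∧ hn ⬝ᵥ P = 0 ∧
      ∀ (z c : ℂ), P ≠ c • cubicPoint L z) ∧
    IsLineSection hl α ∧ IsLineSection hn β ∧ IsLineSection hm γ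

/-! ### Relations -/

/-- The formal antisymmetry relation `[ξ] + [-ξ]`. -/
def antisymmetryRel {L : PeriodPair} (ξ : Curve L) : PointGroup L := cls ξ + cls (-ξ)

/-- The formal relation `∑ᵢⱼ ([αᵢ - βⱼ] + [βᵢ - γⱼ] + [γᵢ - αⱼ])`. -/
def blochRel {L : PeriodPair} {n : ℕ} (α β γ : Fin n → Curve L) : PointGroup L :=
  ∑ i, ∑ j, (cls (α i - β j) + cls (β i - γ j) + cls (γ i - α j))

/-- The left-hand side `∑ᵢⱼ (D_τ(αᵢ - βⱼ) + D_τ(βᵢ - γⱼ) + D_τ(γᵢ - αⱼ))`. -/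
def blochSum (τ : ℂ) (hτ : τ.im ≠ 0) {n : ℕ} (α β γ : Fin n → Curve (periods τ hτ)) : ℝ :=
  ∑ i, ∑ j, (ellDilog τ hτ (α i - β j) + ellDilog τ hτ (β i - γ j) + ellDilog τ hτ (γ i - α j))

end EllipticDilog

end

noncomputable section

namespace EllipticDilog

open Complex Filter Topology

/-! ### Theta functions on `ℂ / ⟨1, τ⟩` -/

section

/-! Let `*` be the biadditive pairing `[x] * [y] = [x - y]` on `ℤ[E]`. Antisymmetry makes it skew,
and modulo the class `[0]` it becomes alternating. If `P`, `Q`, `R` are the fibres of `f` over `0`,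
`1`, `∞`, the Bloch element of `f` is `P * Q + Q * R + R * P`, which is congruent to `(P - R) * (Q -
R)`, the symbol `(f) * (1 - f)`. For any alternating pairing such symbols satisfy the five-term
relation between `f`, `g`, `f / g`, `(1 - f) / (1 - g)` and `f (1 - g) / (g (1 - f))`
(`pairing_mem_of_five_term`). A good choice of `g` therefore trades `f` for functions of more
convenient degree.

In degree `n ≥ 4`, let `g` have degree at most three and share two zeros, two poles and two
`1`-points with `f`. The cancellations bring all four other functions below degree `n`. Such a `g`
is a quotient of theta functions with one free parameter, found by a zero count
(`exists_interpolating`); if the prescribed zeros and poles have equal sums, a function of degree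
two sharing a single `1`-point suffices. The construction needs two distinct points in some fibre,
which Riemann-Hurwitz guarantees for `n ≥ 4`.

Degree one does not occur. In degree two, `g = f u` with `u` generic of degree three makes all four
other functions of degree exactly three (`IsFibreTriple.mem_of_degree_two`). In degree three, a
translation makes the poles sum to zero. Then `f = l / m` and `1 - f = n / m` for linear forms in
`℘, ℘', 1` with `m = n + l`, so the relation of `f` is one of concurrent lines
(`relationsVanish_three`).

Finally `[0]` has to be removed. Every generating relation used has an even coefficient at `0`, the
Bloch element has coefficient zero there, and `2[0]` is an antisymmetry relation
(`mem_relations_of_apply_zero`).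

The analytic input is Abel's theorem: a divisor is principal exactly when its degree and its sum
vanish. Both directions come from comparing a function with a product of theta functions. -/

/-- The infinite product `∏ (1 - qⁿ w)` for `q = exp (2πiτ)`, `w = exp (2πiz)`. -/
def qProduct (τ z : ℂ) : ℂ := ∏' n : ℕ, (1 + -exp (2 * Real.pi * I * (z + n * τ)))

theorem norm_exp_two_pi_I (z : ℂ) :
    ‖exp (2 * Real.pi * I * z)‖ = Real.exp (-(2 * Real.pi * z.im)) := by
  rw [norm_exp]
  congr 1
  simp

theorem summable_qProduct_bound {τ : ℂ} (hτ : 0 < τ.im) (R : ℝ) :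
    Summable fun n : ℕ => Real.exp (2 * Real.pi * R) * Real.exp (-(2 * Real.pi * τ.im)) ^ n := by
  refine (summable_geometric_of_lt_one (Real.exp_pos _).le ?_).mul_left _
  rw [Real.exp_lt_one_iff]
  have := Real.pi_pos
  nlinarith [mul_pos this hτ]

theorem norm_qProduct_term_le {τ : ℂ} {R : ℝ} {z : ℂ} (hz : -R ≤ z.im) (n : ℕ) :
    ‖-exp (2 * Real.pi * I * (z + n * τ))‖ ≤
      Real.exp (2 * Real.pi * R) * Real.exp (-(2 * Real.pi * τ.im)) ^ n := by
  rw [norm_neg, norm_exp_two_pi_I, ← Real.exp_nat_mul, ← Real.exp_add, Real.exp_le_exp]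
  have him : (z + n * τ).im = z.im + n * τ.im := by simp
  rw [him]
  have := Real.pi_pos
  nlinarith [mul_le_mul_of_nonneg_left hz this.le]

theorem differentiable_qProduct {τ : ℂ} (hτ : 0 < τ.im) : Differentiable ℂ (qProduct τ) := by
  intro z
  have hopen : IsOpen {w : ℂ | -(-z.im + 1) < w.im} :=
    isOpen_lt continuous_const Complex.continuous_im
  have h := Summable.hasProdLocallyUniformlyOn_nat_one_add (K := {w : ℂ | -(-z.im + 1) < w.im})
    (f := fun n w => -exp (2 * Real.pi * I * (w + n * τ))) hopen
    (summable_qProduct_bound hτ (-z.im + 1))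
    (Eventually.of_forall fun n w hw => norm_qProduct_term_le (le_of_lt hw) n)
    (fun n => by fun_prop)
  have hd : DifferentiableOn ℂ (qProduct τ) {w : ℂ | -(-z.im + 1) < w.im} :=
    h.differentiableOn (.of_forall fun _ => by
      simpa [Finset.prod_fn] using DifferentiableOn.finsetProd (fun _ _ => by fun_prop)) hopen
  exact (hd z (by simp)).differentiableAt (hopen.mem_nhds (by simp))

theorem summable_qProduct_term {τ : ℂ} (hτ : 0 < τ.im) (z : ℂ) :
    Summable fun n : ℕ => ‖-exp (2 * Real.pi * I * (z + n * τ))‖ :=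
  Summable.of_nonneg_of_le (fun _ => norm_nonneg _)
    (fun n => norm_qProduct_term_le (R := -z.im) (by simp) n) (summable_qProduct_bound hτ _)

theorem qProduct_eq_mul {τ : ℂ} (hτ : 0 < τ.im) (z : ℂ) :
    qProduct τ z = (1 - exp (2 * Real.pi * I * z)) * qProduct τ (z + τ) := by
  have hshift (n : ℕ) : z + (n + 1 : ℕ) * τ = z + τ + n * τ := by push_cast; ring
  let f : ℕ → ℂ := fun n => 1 + -exp (2 * Real.pi * I * (z + n * τ))
  have hf (n : ℕ) : f (n + 1) = 1 + -exp (2 * Real.pi * I * (z + τ + n * τ)) := by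
    simp only [f, hshift]
  have h : Multipliable fun n : ℕ => f (n + 1) := by
    simp only [hf]
    exact multipliable_one_add_of_summable (summable_qProduct_term hτ (z + τ))
  have h0 : f 0 = 1 - exp (2 * Real.pi * I * z) := by simp [f, sub_eq_add_neg]
  calc qProduct τ z = ∏' n, f n := rfl
    _ = f 0 * ∏' n, f (n + 1) := tprod_eq_zero_mul' h
    _ = _ := by rw [h0, tprod_congr hf]; rfl

theorem qProduct_add_one (τ z : ℂ) : qProduct τ (z + 1) = qProduct τ z := by
  refine tprod_congr fun n => ?_
  rw [show 2 * Real.pi * I * (z + 1 + n * τ) = 2 * Real.pi * I * (z + n * τ) + 2 * Real.pi * I by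
    ring, exp_periodic]

theorem qProduct_ne_zero {τ : ℂ} (hτ : 0 < τ.im) {z : ℂ}
    (hz : ∀ (n : ℕ) (m : ℤ), z + n * τ ≠ m) : qProduct τ z ≠ 0 := by
  refine tprod_one_add_ne_zero_of_summable (fun n h => ?_) (summable_qProduct_term hτ z)
  rw [← sub_eq_add_neg, sub_eq_zero, eq_comm, exp_eq_one_iff] at h
  obtain ⟨m, hm⟩ := h
  refine hz n m (mul_right_cancel₀ two_pi_I_ne_zero (Eq.trans ?_ hm))
  ring

/-- An entire function with simple zeros exactly at the points of `ℤ + ℤτ` which is periodic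
under `1` and quasi-periodic under `τ`. -/
structure ThetaFunction (τ : ℂ) where
  /-- the function -/
  toFun : ℂ → ℂ
  /-- the logarithmic multiplier -/
  κ : ℂ
  /-- the constant of the multiplier -/
  c : ℂ
  κ_eq : κ = 2 * Real.pi * I ∨ κ = -(2 * Real.pi * I)
  differentiable : Differentiable ℂ toFun
  eq_zero : ∀ z, toFun z = 0 → ∃ a b : ℤ, z = a + b * τ
  order_zero : meromorphicOrderAt toFun 0 = 1
  add_one : ∀ z, toFun (z + 1) = toFun z
  add_period : ∀ z, toFun (z + τ) = exp (κ * z + c) * toFun z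

/-- Jacobi's product: `qProduct τ z` carries the zeros `m - nτ` with `n ≥ 0`, and `qProduct τ (τ -
z)` the remaining lattice points. -/
theorem nonempty_thetaFunction_of_pos {τ : ℂ} (hτ : 0 < τ.im) : Nonempty (ThetaFunction τ) := by
  have hd := differentiable_qProduct hτ
  -- Splitting off the factor `n = 0` isolates the simple zero at the origin; the cofactor does not
  -- vanish there.
  have hprod (z : ℂ) : qProduct τ z * qProduct τ (τ - z) =
      (1 - exp (2 * Real.pi * I * z)) * (qProduct τ (z + τ) * qProduct τ (τ - z)) := by
    rw [qProduct_eq_mul hτ z]; ring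
  refine ⟨⟨fun z => qProduct τ z * qProduct τ (τ - z), -(2 * Real.pi * I), Real.pi * I, Or.inr rfl,
    by fun_prop, ?_, ?_, ?_, ?_⟩⟩
  · intro z hz
    rcases mul_eq_zero.1 hz with h | h
    · by_contra hcon
      push Not at hcon
      refine qProduct_ne_zero hτ (fun n m hnm => hcon m (-n) ?_) h
      push_cast
      linear_combination hnm
    · by_contra hcon
      push Not at hcon
      refine qProduct_ne_zero hτ (fun n m hnm => hcon (-m) (n + 1) ?_) h
      push_cast
      linear_combination -hnm
  · have h1 : meromorphicOrderAt (fun z : ℂ => 1 - exp (2 * Real.pi * I * z)) 0 = 1 := by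
      have han : AnalyticAt ℂ (fun z : ℂ => 1 - exp (2 * Real.pi * I * z)) 0 := by fun_prop
      have hder : deriv (fun z : ℂ => 1 - exp (2 * Real.pi * I * z)) 0 ≠ 0 := by
        have : HasDerivAt (fun z : ℂ => 1 - exp (2 * Real.pi * I * z))
            (-(exp (2 * Real.pi * I * 0) * (2 * Real.pi * I * 1))) 0 :=
          (((hasDerivAt_id (0 : ℂ)).const_mul (2 * Real.pi * I)).cexp).const_sub 1
        rw [this.deriv]
        simp [Real.pi_ne_zero]
      have := han.analyticOrderAt_sub_eq_one_of_deriv_ne_zero hder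
      simp only [mul_zero, exp_zero, sub_self, sub_zero] at this
      rw [han.meromorphicOrderAt_eq, this]
      rfl
    have h2 : meromorphicOrderAt (fun z : ℂ => qProduct τ (z + τ) * qProduct τ (τ - z)) 0 = 0 := by
      have han : AnalyticAt ℂ (fun z : ℂ => qProduct τ (z + τ) * qProduct τ (τ - z)) 0 :=
        (show Differentiable ℂ _ by fun_prop).analyticAt 0
      have hne : qProduct τ τ ≠ 0 := by
        refine qProduct_ne_zero hτ fun n m h => ?_
        have him := congrArg Complex.im h
        simp at him
        have : (0 : ℝ) ≤ n := Nat.cast_nonneg n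
        nlinarith
      rw [han.meromorphicNFAt.meromorphicOrderAt_eq_zero_iff]
      simpa using hne
    rw [show (fun z => qProduct τ z * qProduct τ (τ - z)) = fun z =>
      (1 - exp (2 * Real.pi * I * z)) * (qProduct τ (z + τ) * qProduct τ (τ - z)) from funext hprod,
      fun_meromorphicOrderAt_mul, h1, h2, add_zero]
    · exact (by fun_prop : AnalyticAt ℂ _ _).meromorphicAt
    · exact ((show Differentiable ℂ _ by fun_prop).analyticAt 0).meromorphicAt
  · intro z
    have := qProduct_add_one τ (τ - z - 1)
    rw [sub_add_cancel] at this
    simp only [qProduct_add_one]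
    rw [this, sub_add_eq_sub_sub]
  · intro z
    have h3 : qProduct τ (-z) = (1 - exp (2 * Real.pi * I * -z)) * qProduct τ (τ - z) := by
      rw [qProduct_eq_mul hτ, neg_add_eq_sub]
    have h4 : exp (2 * Real.pi * I * -z) * exp (2 * Real.pi * I * z) = 1 := by
      rw [← exp_add, ← exp_zero]; ring_nf
    simp only [hprod z, sub_add_cancel_right, h3]
    rw [exp_add, exp_pi_mul_I, show -(2 * Real.pi * I) * z = 2 * Real.pi * I * -z by ring]
    linear_combination -(qProduct τ (z + τ) * qProduct τ (τ - z)) * h4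

/-- For `τ` in the lower half-plane the function of `-τ` serves, since the lattice is the same. Its
multiplier is inverted, which is why both signs of `κ` are allowed. -/
theorem nonempty_thetaFunction {τ : ℂ} (hτ : τ.im ≠ 0) : Nonempty (ThetaFunction τ) := by
  rcases lt_or_gt_of_ne hτ with h | h
  · obtain ⟨θ⟩ := nonempty_thetaFunction_of_pos (τ := -τ) (by simpa using h)
    refine ⟨⟨θ.toFun, -θ.κ, θ.κ * -τ - θ.c, ?_, θ.differentiable, ?_, θ.order_zero, θ.add_one, ?_⟩⟩
    · rcases θ.κ_eq with h | h <;> simp [h]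
    · intro z hz
      obtain ⟨a, b, hab⟩ := θ.eq_zero z hz
      exact ⟨a, -b, by rw [hab]; push_cast; ring⟩
    · intro z
      have := θ.add_period (z + τ)
      rw [add_neg_cancel_right] at this
      rw [this, ← mul_assoc, ← exp_add]
      ring_nf
      simp
  · exact nonempty_thetaFunction_of_pos h

end

section

variable {L : PeriodPair}

/-! ### Points of the curve -/

theorem pt_add (z w : ℂ) : pt L (z + w) = pt L z + pt L w := rfl

theorem pt_sub (z w : ℂ) : pt L (z - w) = pt L z - pt L w := rfl

theorem pt_eq_pt_iff {z w : ℂ} : pt L z = pt L w ↔ z - w ∈ L.lattice :=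
  Submodule.Quotient.eq _

theorem pt_eq_zero_iff {z : ℂ} : pt L z = 0 ↔ z ∈ L.lattice :=
  Submodule.Quotient.mk_eq_zero _

theorem pt_surjective : Function.Surjective (pt L) := Submodule.Quotient.mk_surjective _

/-- A complex number representing a point of the curve. -/
def rep (p : Curve L) : ℂ := (pt_surjective p).choose

@[simp] theorem pt_rep (p : Curve L) : pt L (rep p) = p := (pt_surjective p).choose_spec

theorem pt_zsmul (n : ℤ) (z : ℂ) : pt L (n * z) = n • pt L z := by
  rw [← zsmul_eq_mul]; rfl

/-- Every complex number is congruent to one of bounded norm. -/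
theorem exists_norm_sub_lattice_le (L : PeriodPair) :
    ∃ R : ℝ, ∀ z : ℂ, ∃ l ∈ L.lattice, ‖z - l‖ ≤ R := by
  refine ⟨∑ i, ‖L.basis i‖, fun z => ⟨ZSpan.floor L.basis z, ?_, ZSpan.norm_fract_le L.basis z⟩⟩
  rw [L.lattice_eq_span_range_basis]
  exact (ZSpan.floor L.basis z).2

/-! ### Entire functions -/

/-- Liouville's theorem: the values are already taken on a compact ball. -/
theorem eq_of_differentiable_of_periodic {f : ℂ → ℂ} (hf : Differentiable ℂ f)
    (hper : ∀ l ∈ L.lattice, Function.Periodic f l) (z w : ℂ) : f z = f w := by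
  refine hf.apply_eq_apply_of_bounded ?_ z w
  obtain ⟨R, hR⟩ := exists_norm_sub_lattice_le L
  refine ((isCompact_closedBall (0 : ℂ) R).image hf.continuous).isBounded.subset ?_
  rintro _ ⟨z, rfl⟩
  obtain ⟨l, hl, hn⟩ := hR z
  exact ⟨z - l, by simpa using hn, (hper l hl).sub_eq z⟩

theorem periodic_of_mem_periods {τ : ℂ} {hτ : τ.im ≠ 0} {X : Type*} {f : ℂ → X}
    (h1 : ∀ z, f (z + 1) = f z) (h2 : ∀ z, f (z + τ) = f z) :
    ∀ l ∈ (periods τ hτ).lattice, Function.Periodic f l := by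
  intro l hl
  obtain ⟨a, b, rfl⟩ := PeriodPair.mem_lattice.1 hl
  have h1' : Function.Periodic f (1 : ℂ) := h1
  have h2' : Function.Periodic f τ := h2
  have := (h1'.int_mul a).add_period (h2'.int_mul b)
  simpa [periods] using this

/-- The multipliers of a nowhere vanishing entire function which is periodic under `1` and
quasi-periodic under `τ`. -/
theorem multiplier_of_nonvanishing {τ : ℂ} (hτ : τ.im ≠ 0) {v : ℂ → ℂ} (hv : Differentiable ℂ v)
    (hv0 : ∀ z, v z ≠ 0) {A B : ℂ} (h1 : ∀ z, v (z + 1) = v z)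
    (h2 : ∀ z, v (z + τ) = exp (A * z + B) * v z) :
    A = 0 ∧ ∃ m k : ℤ, B = 2 * Real.pi * I * (m * τ + k) := by
  have hv' : Differentiable ℂ (deriv v) := by
    intro z
    exact ((hv.analyticAt z).deriv).differentiableAt
  have d1 (z : ℂ) : deriv v (z + 1) = deriv v z := by
    rw [← deriv_comp_add_const, funext h1]
  have d2 (z : ℂ) : deriv v (z + τ) = exp (A * z + B) * (deriv v z + A * v z) := by
    rw [← deriv_comp_add_const, funext h2]
    have hA : HasDerivAt (fun z => exp (A * z + B)) (exp (A * z + B) * (A * 1)) z :=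
      (((hasDerivAt_id z).const_mul A).add_const B).cexp
    rw [(hA.fun_mul (hv z).hasDerivAt).deriv]
    ring
  -- The logarithmic derivative is entire, `1`-periodic, and changes by the constant `A` under `τ`.
  -- Its derivative is thus elliptic and constant, so `w` is affine; the period `1` kills the slope,
  -- hence `A = 0` and `v` is an exponential.
  set w : ℂ → ℂ := fun z => deriv v z / v z with hw
  have hwd : Differentiable ℂ w := hv'.div hv hv0
  have w1 (z : ℂ) : w (z + 1) = w z := by simp only [hw, d1, h1]
  have w2 (z : ℂ) : w (z + τ) = w z + A := by
    simp only [hw, d2, h2]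
    have := hv0 z
    have := exp_ne_zero (A * z + B)
    field_simp
  have hwd' : Differentiable ℂ (deriv w) := by
    intro z
    exact ((hwd.analyticAt z).deriv).differentiableAt
  have hc := eq_of_differentiable_of_periodic (L := periods τ hτ) hwd'
    (periodic_of_mem_periods (fun z => by rw [← deriv_comp_add_const, funext w1])
      (fun z => by rw [← deriv_comp_add_const, funext w2]; simp))
  have hlin (z : ℂ) : w z = w 0 + deriv w 0 * z := by
    have hd : Differentiable ℂ fun z => w z - deriv w 0 * z := by fun_prop
    have := is_const_of_deriv_eq_zero hd (fun x => by
      rw [deriv_fun_sub (hwd x) (by fun_prop), hc x 0]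
      simp) z 0
    linear_combination this
  have hc0 : deriv w 0 = 0 := by
    have := w1 0
    rw [hlin (0 + 1)] at this
    linear_combination this
  have hA : A = 0 := by
    have := w2 0
    rw [hlin (0 + τ), hc0] at this
    linear_combination -this
  refine ⟨hA, ?_⟩
  have hvexp (z : ℂ) : v z = v 0 * exp (w 0 * z) := by
    have hd : Differentiable ℂ fun z => v z * exp (-(w 0 * z)) := by fun_prop
    have := is_const_of_deriv_eq_zero hd (fun x => by
      have hE : HasDerivAt (fun z => exp (-(w 0 * z))) (exp (-(w 0 * x)) * -(w 0 * 1)) x :=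
        (((hasDerivAt_id x).const_mul (w 0)).neg).cexp
      rw [((hv x).hasDerivAt.fun_mul hE).deriv]
      have : deriv v x = w 0 * v x := by
        rw [← div_eq_iff (hv0 x)]
        have := hlin x
        rw [hc0, zero_mul, add_zero] at this
        exact this
      rw [this]; ring) z 0
    simp only [mul_zero, neg_zero, exp_zero, mul_one] at this
    rw [← this, mul_assoc, ← exp_add]
    simp
  have e1 : exp (w 0) = 1 := by
    have := h1 0
    rw [hvexp (0 + 1)] at this
    simpa [hv0 0] using this
  have e2 : exp (w 0 * τ) = exp B := by
    have := h2 0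
    rw [hvexp (0 + τ), hA, mul_comm] at this
    simpa [hv0 0] using this
  obtain ⟨m, hm⟩ := exp_eq_one_iff.1 e1
  obtain ⟨k, hk⟩ := exp_eq_exp_iff_exists_int.1 e2
  refine ⟨m, -k, ?_⟩
  rw [hm] at hk
  push_cast
  linear_combination -hk

/-! ### Elliptic functions and their divisors -/

namespace IsRationalFunction

variable {f g : ℂ → ℂ}

theorem const (L : PeriodPair) (c : ℂ) : IsRationalFunction L fun _ => c :=
  ⟨fun _ => .const c _, fun _ _ _ => rfl⟩

theorem mul (hf : IsRationalFunction L f) (hg : IsRationalFunction L g) :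
    IsRationalFunction L fun z => f z * g z :=
  ⟨fun z => (hf.1 z).mul (hg.1 z), fun l hl z => by simp only [hf.2 l hl z, hg.2 l hl z]⟩

theorem add (hf : IsRationalFunction L f) (hg : IsRationalFunction L g) :
    IsRationalFunction L fun z => f z + g z :=
  ⟨fun z => (hf.1 z).add (hg.1 z), fun l hl z => by simp only [hf.2 l hl z, hg.2 l hl z]⟩

theorem sub (hf : IsRationalFunction L f) (hg : IsRationalFunction L g) :
    IsRationalFunction L fun z => f z - g z :=
  ⟨fun z => (hf.1 z).sub (hg.1 z), fun l hl z => by simp only [hf.2 l hl z, hg.2 l hl z]⟩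

theorem inv (hf : IsRationalFunction L f) : IsRationalFunction L fun z => (f z)⁻¹ :=
  ⟨fun z => (hf.1 z).inv, fun l hl z => by simp only [hf.2 l hl z]⟩

theorem div (hf : IsRationalFunction L f) (hg : IsRationalFunction L g) :
    IsRationalFunction L fun z => f z / g z :=
  ⟨fun z => (hf.1 z).div (hg.1 z), fun l hl z => by simp only [hf.2 l hl z, hg.2 l hl z]⟩

theorem one_sub (hf : IsRationalFunction L f) : IsRationalFunction L fun z => 1 - f z :=
  (const L 1).sub hf

theorem comp_add (hf : IsRationalFunction L f) (t : ℂ) :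
    IsRationalFunction L fun z => f (z + t) :=
  ⟨fun z => meromorphicAt_fun_comp_add_const_iff_meromorphicAt.2 (hf.1 _), fun l hl z => by
    simp only [add_right_comm z l t, hf.2 l hl (z + t)]⟩

theorem order_add (hf : IsRationalFunction L f) {l : ℂ} (hl : l ∈ L.lattice) (z : ℂ) :
    meromorphicOrderAt f (z + l) = meromorphicOrderAt f z := by
  rw [← meromorphicOrderAt_fun_comp_add_const_eq_meromorphicOrderAt]
  exact congrArg (meromorphicOrderAt · z) (funext (hf.2 l hl))

theorem order_congr (hf : IsRationalFunction L f) {z w : ℂ} (h : pt L z = pt L w) :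
    meromorphicOrderAt f z = meromorphicOrderAt f w := by
  have := hf.order_add (pt_eq_pt_iff.1 h) w
  rwa [add_sub_cancel] at this

theorem order_ne_top (hf : IsRationalFunction L f) {z : ℂ} (h : meromorphicOrderAt f z ≠ ⊤)
    (w : ℂ) : meromorphicOrderAt f w ≠ ⊤ :=
  MeromorphicOn.meromorphicOrderAt_ne_top_of_isPreconnected (U := Set.univ)
    (fun z _ => hf.1 z) isPreconnected_univ (Set.mem_univ z) (Set.mem_univ w) h

/-- A non-zero elliptic function has a divisor. -/
theorem exists_hasDivisor (hf : IsRationalFunction L f) {z : ℂ}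
    (h : meromorphicOrderAt f z ≠ ⊤) : ∃ D : PointGroup L, HasDivisor f D := by
  obtain ⟨R, hR⟩ := exists_norm_sub_lattice_le L
  have hmer : MeromorphicOn f (Metric.closedBall 0 R) := fun z _ => hf.1 z
  have hfin := (MeromorphicOn.divisor f (Metric.closedBall 0 R)).finiteSupport
    (isCompact_closedBall 0 R)
  have hsupp : (Function.support fun p : Curve L => (meromorphicOrderAt f (rep p)).untop₀).Finite := by
    refine (hfin.image (pt L)).subset fun p hp => ?_
    obtain ⟨l, hl, hn⟩ := hR (rep p)
    have hpt : pt L (rep p - l) = p := by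
      rw [pt_sub, pt_eq_zero_iff.2 hl, sub_zero, pt_rep]
    refine ⟨rep p - l, ?_, hpt⟩
    rw [Function.mem_support, MeromorphicOn.divisor_apply hmer (by simpa using hn)]
    rwa [hf.order_congr (w := rep p) (by rw [hpt, pt_rep])]
  refine ⟨Finsupp.ofSupportFinite _ hsupp, fun w => ?_⟩
  rw [Finsupp.ofSupportFinite_coe, hf.order_congr (z := rep (pt L w)) (w := w) (pt_rep _),
    WithTop.coe_untop₀_of_ne_top (hf.order_ne_top h w)]

end IsRationalFunction

namespace HasDivisor

variable {f g : ℂ → ℂ} {D D' : PointGroup L}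

theorem order_ne_top (h : HasDivisor f D) (z : ℂ) : meromorphicOrderAt f z ≠ ⊤ := by
  rw [h z]; exact WithTop.coe_ne_top

theorem eventually_ne_zero (h : HasDivisor f D) (hf : IsRationalFunction L f) (z : ℂ) :
    ∀ᶠ w in 𝓝[≠] z, f w ≠ 0 :=
  (meromorphicOrderAt_ne_top_iff_eventually_ne_zero (hf.1 z)).1 (h.order_ne_top z)

theorem congr (h : HasDivisor f D) (hfg : ∀ z, f =ᶠ[𝓝[≠] z] g) : HasDivisor g D := fun z => by
  rw [← meromorphicOrderAt_congr (hfg z), h z]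

theorem unique (h : HasDivisor f D) (h' : HasDivisor f D') : D = D' := by
  ext p
  obtain ⟨z, rfl⟩ := pt_surjective p
  have := (h z).symm.trans (h' z)
  exact_mod_cast this

theorem mul (hf : IsRationalFunction L f) (hg : IsRationalFunction L g) (h : HasDivisor f D)
    (h' : HasDivisor g D') : HasDivisor (fun z => f z * g z) (D + D') := fun z => by
  rw [fun_meromorphicOrderAt_mul (hf.1 z) (hg.1 z), h z, h' z]; rfl

theorem inv (h : HasDivisor f D) : HasDivisor (fun z => (f z)⁻¹) (-D) := fun z => by
  rw [fun_meromorphicOrderAt_inv, h z]; rfl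

theorem div (hf : IsRationalFunction L f) (hg : IsRationalFunction L g) (h : HasDivisor f D)
    (h' : HasDivisor g D') : HasDivisor (fun z => f z / g z) (D - D') := fun z => by
  rw [fun_meromorphicOrderAt_div (hf.1 z) (hg.1 z), h z, h' z]; rfl

theorem const {c : ℂ} (hc : c ≠ 0) : HasDivisor (L := L) (fun _ => c) 0 := fun z => by
  classical
  rw [meromorphicOrderAt_const, if_neg hc]; rfl

theorem neg (h : HasDivisor f D) : HasDivisor (fun z => -f z) D := fun z => by
  rw [← meromorphicOrderAt_fun_neg, h z]

/-- If `f - g` vanishes identically then `f` and `g` have the same divisor; otherwise it has a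
divisor. -/
theorem exists_sub (hf : IsRationalFunction L f) (hg : IsRationalFunction L g)
    (h : HasDivisor f D) (h' : HasDivisor g D') (hne : D ≠ D') :
    ∃ E : PointGroup L, HasDivisor (fun z => f z - g z) E := by
  by_cases htop : ∃ z, meromorphicOrderAt (fun z => f z - g z) z ≠ ⊤
  · obtain ⟨z, hz⟩ := htop
    exact (hf.sub hg).exists_hasDivisor hz
  · push Not at htop
    refine absurd (h.unique (h'.congr fun z => ?_)) hne
    filter_upwards [meromorphicOrderAt_eq_top_iff.1 (htop z)] with w hw
    exact (sub_eq_zero.1 hw).symm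

end HasDivisor

end

section

/-! ### Degree and sum of a divisor -/

/-- The sum in the group `ℂ / Λ` of the points of a divisor. -/
def pointSum {L : PeriodPair} : PointGroup L →+ Curve L :=
  Finsupp.liftAddHom fun p => zmultiplesHom (Curve L) p

section

variable {L : PeriodPair}

@[simp] theorem pointSum_cls (p : Curve L) : pointSum (cls p) = p := by
  simp [pointSum, cls]

@[simp] theorem degree_cls (p : Curve L) : Finsupp.degree (cls p) = 1 := by simp [cls]

theorem pointSum_eq_pt (D : PointGroup L) :
    pointSum D = pt L (∑ p ∈ D.support, D p * rep p) := by
  have : pt L (∑ p ∈ D.support, D p * rep p) = ∑ p ∈ D.support, pt L (D p * rep p) :=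
    map_sum L.lattice.mkQ _ _
  rw [this, pointSum, Finsupp.liftAddHom_apply, Finsupp.sum]
  refine Finset.sum_congr rfl fun p _ => ?_
  rw [pt_zsmul, pt_rep]
  simp

end

/-- A meromorphic function of order zero everywhere agrees with a nowhere vanishing entire
function up to removable singularities. -/
theorem exists_entire_of_order_eq_zero {u : ℂ → ℂ} (hu : Meromorphic u)
    (h0 : ∀ z, meromorphicOrderAt u z = 0) :
    ∃ v : ℂ → ℂ, Differentiable ℂ v ∧ (∀ z, v z ≠ 0) ∧ ∀ z, v =ᶠ[𝓝[≠] z] u := by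
  have hmer : MeromorphicOn u Set.univ := fun z _ => hu z
  have hnf (z : ℂ) := meromorphicNFOn_toMeromorphicNFOn u Set.univ (Set.mem_univ z)
  have hord (z : ℂ) : meromorphicOrderAt (toMeromorphicNFOn u Set.univ) z = 0 := by
    rw [meromorphicOrderAt_toMeromorphicNFOn hmer (Set.mem_univ z), h0]
  refine ⟨toMeromorphicNFOn u Set.univ, fun z => ?_, fun z => ?_, fun z => ?_⟩
  · exact ((hnf z).meromorphicOrderAt_nonneg_iff_analyticAt.1 (hord z).ge).differentiableAt
  · exact (hnf z).meromorphicOrderAt_eq_zero_iff.1 (hord z)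
  · exact hmer.toMeromorphicNFOn_eq_self_on_nhdsNE (Set.mem_univ z)

theorem eq_of_eventuallyEq_punctured {f g : ℂ → ℂ} (hf : Differentiable ℂ f)
    (hg : Differentiable ℂ g) {z : ℂ} (h : f =ᶠ[𝓝[≠] z] g) : f z = g z :=
  (((hf z).continuousAt.eventuallyEq_nhds_iff_eventuallyEq_nhdsNE (hg z).continuousAt).1 h).self_of_nhds

theorem eventually_punctured_add {p : ℂ → Prop} {z t : ℂ} (h : ∀ᶠ w in 𝓝[≠] (z + t), p w) :
    ∀ᶠ w in 𝓝[≠] z, p (w + t) := by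
  refine (tendsto_nhdsWithin_iff.2 ⟨?_, ?_⟩ : Tendsto (· + t) (𝓝[≠] z) (𝓝[≠] (z + t))).eventually h
  · exact ((continuous_id.add continuous_const).tendsto z).mono_left nhdsWithin_le_nhds
  · filter_upwards [self_mem_nhdsWithin] with w hw
    simpa using hw

namespace ThetaFunction

variable {τ : ℂ} (θ : ThetaFunction τ)

/-- The multipliers never vanish, so the order of `θ` is itself a doubly periodic function of the
point. -/
theorem order_lattice (hτ : τ.im ≠ 0) {l : ℂ} (hl : l ∈ (periods τ hτ).lattice) :
    meromorphicOrderAt θ.toFun l = 1 := by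
  have h := periodic_of_mem_periods (hτ := hτ) (f := fun z => meromorphicOrderAt θ.toFun z)
    (fun z => by
      simp only [← meromorphicOrderAt_fun_comp_add_const_eq_meromorphicOrderAt, θ.add_one])
    (fun z => by
      simp only [← meromorphicOrderAt_fun_comp_add_const_eq_meromorphicOrderAt, θ.add_period]
      exact meromorphicOrderAt_mul_of_ne_zero (g := fun z => exp (θ.κ * z + θ.c)) (by fun_prop)
        (exp_ne_zero _)) l hl 0
  rw [zero_add] at h
  exact h.trans θ.order_zero

theorem eq_zero_iff (hτ : τ.im ≠ 0) {z : ℂ} : θ.toFun z = 0 ↔ pt (periods τ hτ) z = 0 := by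
  constructor
  · intro h
    obtain ⟨a, b, rfl⟩ := θ.eq_zero z h
    rw [pt_eq_zero_iff, PeriodPair.mem_lattice]
    exact ⟨a, b, by simp [periods]⟩
  · intro h
    by_contra hne
    have := (θ.differentiable.analyticAt z).meromorphicNFAt.meromorphicOrderAt_eq_zero_iff.2 hne
    rw [θ.order_lattice hτ (pt_eq_zero_iff.1 h)] at this
    exact one_ne_zero this

theorem order_sub (hτ : τ.im ≠ 0) (a z : ℂ) : meromorphicOrderAt (fun z => θ.toFun (z - a)) z =
    ((cls (pt (periods τ hτ) a) (pt (periods τ hτ) z) : ℤ) : WithTop ℤ) := by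
  classical
  rw [meromorphicOrderAt_fun_comp_sub_const_eq_meromorphicOrderAt, cls, Finsupp.single_apply]
  have hsub : pt (periods τ hτ) a = pt (periods τ hτ) z ↔ pt (periods τ hτ) (z - a) = 0 := by
    rw [pt_sub, sub_eq_zero, eq_comm]
  split_ifs with h
  · exact θ.order_lattice hτ (pt_eq_zero_iff.1 (hsub.1 h))
  · exact (θ.differentiable.analyticAt _).meromorphicNFAt.meromorphicOrderAt_eq_zero_iff.2
      fun h0 => h (hsub.2 ((θ.eq_zero_iff hτ).1 h0))

theorem κ_mul_int (θ : ThetaFunction τ) (n : ℤ) : exp (θ.κ * n) = 1 := by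
  rw [exp_eq_one_iff]
  rcases θ.κ_eq with h | h
  · exact ⟨n, by rw [h]; ring⟩
  · exact ⟨-n, by rw [h]; push_cast; ring⟩

theorem κ_ne_zero (θ : ThetaFunction τ) : θ.κ ≠ 0 := by
  rcases θ.κ_eq with h | h <;> simp [h, Real.pi_ne_zero]

/-- The product of the functions `θ(z - p)` to the powers prescribed by a divisor. -/
def divisorProd {hτ : τ.im ≠ 0} (D : PointGroup (periods τ hτ)) (z : ℂ) : ℂ :=
  ∏ p ∈ D.support, θ.toFun (z - rep p) ^ D p

variable {hτ : τ.im ≠ 0} (D : PointGroup (periods τ hτ))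

theorem meromorphic_factor (a : ℂ) (n : ℤ) (z : ℂ) :
    MeromorphicAt (fun z => θ.toFun (z - a) ^ n) z :=
  MeromorphicAt.fun_zpow (AnalyticAt.meromorphicAt
    ((show Differentiable ℂ fun z => θ.toFun (z - a) from
      θ.differentiable.comp (by fun_prop)).analyticAt z)) n

theorem meromorphic_divisorProd : Meromorphic (θ.divisorProd D) := fun z =>
  MeromorphicAt.fun_prod fun _ _ => θ.meromorphic_factor _ _ z

theorem hasDivisor_divisorProd : HasDivisor (θ.divisorProd D) D := fun z => by
  classical
  have hfac (p : Curve (periods τ hτ)) :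
      meromorphicOrderAt (fun z => θ.toFun (z - rep p) ^ D p) z =
        ((D p * cls p (pt _ z) : ℤ) : WithTop ℤ) := by
    rw [fun_meromorphicOrderAt_zpow, θ.order_sub hτ, pt_rep]
    · rfl
    · simpa using θ.meromorphic_factor (rep p) 1 z
  unfold divisorProd
  rw [meromorphicOrderAt_fun_prod fun p _ => θ.meromorphic_factor _ _ z,
    Finset.sum_congr rfl fun p _ => hfac p, ← WithTop.coe_sum]
  congr 1
  simp only [cls, Finsupp.single_apply, mul_ite, mul_one, mul_zero, Finset.sum_ite_eq',
    Finsupp.mem_support_iff, ite_not]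
  exact ite_eq_right_iff.2 Eq.symm

theorem divisorProd_add_one (z : ℂ) : θ.divisorProd D (z + 1) = θ.divisorProd D z := by
  refine Finset.prod_congr rfl fun p _ => ?_
  rw [add_sub_right_comm, θ.add_one]

/-- The source of Abel's theorem: the multiplier sees a divisor only through its degree and the sum
of its representatives. -/
theorem divisorProd_add_period (z : ℂ) : θ.divisorProd D (z + τ) =
    exp (θ.κ * Finsupp.degree D * z + (θ.c * Finsupp.degree D -
      θ.κ * ∑ p ∈ D.support, D p * rep p)) * θ.divisorProd D z := by
  have h (p : Curve (periods τ hτ)) : θ.toFun (z + τ - rep p) ^ D p =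
      exp (D p * (θ.κ * (z - rep p) + θ.c)) * θ.toFun (z - rep p) ^ D p := by
    rw [add_sub_right_comm, θ.add_period, mul_zpow, exp_int_mul]
  unfold divisorProd
  simp only [h]
  rw [Finset.prod_mul_distrib, ← exp_sum]
  congr 2
  rw [Finsupp.degree_apply, Int.cast_sum]
  simp only [Finset.mul_sum, Finset.sum_mul, ← Finset.sum_sub_distrib, ← Finset.sum_add_distrib]
  refine Finset.sum_congr rfl fun p _ => ?_
  ring

end ThetaFunction

variable {τ : ℂ} {hτ : τ.im ≠ 0}

/-- The divisor of an elliptic function has degree zero and sum zero. -/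
theorem HasDivisor.degree_and_pointSum {f : ℂ → ℂ} {D : PointGroup (periods τ hτ)}
    (hf : IsRationalFunction (periods τ hτ) f) (h : HasDivisor f D) :
    Finsupp.degree D = 0 ∧ pointSum D = 0 := by
  obtain ⟨θ⟩ := nonempty_thetaFunction hτ
  have hmer : Meromorphic fun z => θ.divisorProd D z / f z := fun z =>
    (θ.meromorphic_divisorProd D z).div (hf.1 z)
  -- The quotient of the theta product by `f` has neither zeros nor poles, and `f` is periodic. The
  -- multiplier of the theta product is therefore that of a nowhere vanishing entire function.
  obtain ⟨v, hv, hv0, hvu⟩ := exists_entire_of_order_eq_zero hmer (fun z => by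
    rw [fun_meromorphicOrderAt_div (θ.meromorphic_divisorProd D z) (hf.1 z),
      θ.hasDivisor_divisorProd D z, h z, ← WithTop.LinearOrderedAddCommGroup.coe_sub, sub_self]
    rfl)
  have f1 (z : ℂ) : f (z + 1) = f z := hf.2 1 (PeriodPair.ω₁_mem_lattice (periods τ hτ)) z
  have f2 (z : ℂ) : f (z + τ) = f z := hf.2 τ (PeriodPair.ω₂_mem_lattice (periods τ hτ)) z
  obtain ⟨hA, m, k, hB⟩ := multiplier_of_nonvanishing hτ hv hv0
    (fun z => eq_of_eventuallyEq_punctured (f := fun z => v (z + 1)) (by fun_prop) hv (by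
      filter_upwards [eventually_punctured_add (hvu (z + 1)), hvu z] with w h1 h2
      rw [h1, h2, θ.divisorProd_add_one, f1]))
    (fun z => eq_of_eventuallyEq_punctured (f := fun z => v (z + τ)) (by fun_prop)
      (g := fun z => exp (θ.κ * Finsupp.degree D * z + (θ.c * Finsupp.degree D -
        θ.κ * ∑ p ∈ D.support, D p * rep p)) * v z) (by fun_prop) (by
      filter_upwards [eventually_punctured_add (hvu (z + τ)), hvu z] with w h1 h2
      rw [h1, h2, θ.divisorProd_add_period, f2, mul_div_assoc]))
  have hdeg : Finsupp.degree D = 0 := by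
    simpa [θ.κ_ne_zero] using hA
  refine ⟨hdeg, ?_⟩
  rw [pointSum_eq_pt, pt_eq_zero_iff, PeriodPair.mem_lattice]
  rw [hdeg, Int.cast_zero, mul_zero, zero_sub] at hB
  rcases θ.κ_eq with h | h
  · refine ⟨-k, -m, mul_left_cancel₀ θ.κ_ne_zero ?_⟩
    change θ.κ * ((-k : ℤ) * 1 + (-m : ℤ) * τ) = _
    push_cast
    linear_combination hB + (-k - m * τ) * h
  · refine ⟨k, m, mul_left_cancel₀ θ.κ_ne_zero ?_⟩
    change θ.κ * (k * 1 + m * τ) = _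
    linear_combination hB + (k + m * τ) * h

/-- A divisor of degree zero and sum zero is the divisor of an elliptic function. -/
theorem exists_hasDivisor_of_pointSum_eq_zero {D : PointGroup (periods τ hτ)}
    (hdeg : Finsupp.degree D = 0) (hsum : pointSum D = 0) :
    ∃ f, IsRationalFunction (periods τ hτ) f ∧ HasDivisor f D := by
  obtain ⟨θ⟩ := nonempty_thetaFunction hτ
  rw [pointSum_eq_pt, pt_eq_zero_iff, PeriodPair.mem_lattice] at hsum
  obtain ⟨a, b, hab⟩ := hsum
  change a * 1 + b * τ = _ at hab
  -- In degree zero the product has the constant multiplier `exp (-κ (a + b τ))` under `τ`. The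
  -- exponential factor absorbs the part with `b`, and what is left is `1` because `κ = ±2πi`.
  refine ⟨fun z => exp (θ.κ * b * z) * θ.divisorProd D z, ⟨fun z => ?_, ?_⟩, fun z => ?_⟩
  · exact (show AnalyticAt ℂ (fun z => exp (θ.κ * b * z)) z by fun_prop).meromorphicAt.mul
      (θ.meromorphic_divisorProd D z)
  · refine periodic_of_mem_periods (fun z => ?_) (fun z => ?_)
    · rw [θ.divisorProd_add_one, mul_add, exp_add, mul_one, θ.κ_mul_int, mul_one]
    · rw [θ.divisorProd_add_period, ← hab, hdeg, ← mul_assoc, ← exp_add]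
      congr 1
      have hexp : θ.κ * b * (z + τ) + (θ.κ * (0 : ℤ) * z + (θ.c * (0 : ℤ) -
          θ.κ * (a * 1 + b * τ))) = θ.κ * b * z + θ.κ * (-a : ℤ) := by
        push_cast; ring
      rw [hexp, exp_add, θ.κ_mul_int, mul_one]
  · exact (meromorphicOrderAt_mul_of_ne_zero (g := fun z => exp (θ.κ * b * z)) (by fun_prop)
      (exp_ne_zero _)).trans (θ.hasDivisor_divisorProd D z)

end

section

variable {L : PeriodPair}

/-! ### The formal pairing and the module of relations -/

/-- The biadditive map with `([x], [y]) ↦ [x - y]`. -/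
def pairing : PointGroup L →+ PointGroup L →+ PointGroup L :=
  Finsupp.liftAddHom fun x => zmultiplesHom _
    (Finsupp.liftAddHom fun y => zmultiplesHom _ (cls (x - y)))

@[simp] theorem pairing_cls (x y : Curve L) : pairing (cls x) (cls y) = cls (x - y) := by
  simp [pairing, cls]

/-- The cyclic sum `P * Q + Q * R + R * P` for the pairing `[x] * [y] = [x - y]`. -/
def cyclicPairing (P Q R : PointGroup L) : PointGroup L :=
  pairing P Q + pairing Q R + pairing R P

theorem blochRel_eq_cyclicPairing {n : ℕ} (α β γ : Fin n → Curve L) :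
    blochRel α β γ = cyclicPairing (∑ i, cls (α i)) (∑ i, cls (β i)) (∑ i, cls (γ i)) := by
  simp only [blochRel, cyclicPairing, map_sum, AddMonoidHom.finsetSum_apply, pairing_cls,
    Finset.sum_add_distrib]
  refine congrArg₂ _ (congrArg₂ _ ?_ ?_) ?_ <;> exact Finset.sum_comm

theorem single_eq_smul_cls (x : Curve L) (m : ℤ) :
    (Finsupp.single x m : PointGroup L) = m • cls x := by
  simp [cls]

/-- The blochRel of pairwise disjoint sections by concurrent lines. -/
def concurrentRels (L : PeriodPair) : Set (PointGroup L) :=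
  {r | ∃ α β γ : Fin 3 → Curve L, IsConcurrentSection α β γ ∧
    (∀ i j, α i ≠ β j ∧ β i ≠ γ j ∧ γ i ≠ α j) ∧ r = blochRel α β γ}

/-- The module generated by antisymmetry relations and relations of concurrent lines. -/
def relations (L : PeriodPair) : Submodule ℤ (PointGroup L) :=
  Submodule.span ℤ (Set.range antisymmetryRel) ⊔ Submodule.span ℤ (concurrentRels L)

/-- The module generated by the relations and the class of the origin. -/
def relationsOrigin (L : PeriodPair) : Submodule ℤ (PointGroup L) :=
  relations L ⊔ Submodule.span ℤ {cls 0}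

theorem antisymmetryRel_mem (x : Curve L) : antisymmetryRel x ∈ relations L :=
  Submodule.mem_sup_left (Submodule.subset_span ⟨x, rfl⟩)

theorem relations_le : relations L ≤ relationsOrigin L := le_sup_left

theorem cls_zero_mem : cls (0 : Curve L) ∈ relationsOrigin L :=
  Submodule.mem_sup_right (Submodule.subset_span rfl)

theorem pairing_add_swap_mem (P Q : PointGroup L) :
    pairing P Q + pairing Q P ∈ relations L := by
  induction P using Finsupp.induction_linear with
  | zero => simp
  | add P P' h h' =>
    have := add_mem h h'
    simp only [map_add, AddMonoidHom.add_apply] at this ⊢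
    convert this using 1
    abel
  | single x m =>
    induction Q using Finsupp.induction_linear with
    | zero => simp
    | add P P' h h' =>
      have := add_mem h h'
      simp only [map_add, AddMonoidHom.add_apply] at this ⊢
      convert this using 1
      abel
    | single y n =>
      have := Submodule.smul_mem _ (m * n) (antisymmetryRel_mem (x - y))
      convert this using 1
      simp only [single_eq_smul_cls, map_zsmul, AddMonoidHom.smul_apply, pairing_cls,
        antisymmetryRel, neg_sub, smul_add, mul_smul]
      rw [smul_comm n m (cls (x - y))]

/-- Diagonal terms are multiples of `[x - x] = [0]`, and off-diagonal terms cancel by antisymmetry.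
Antisymmetry alone provides only `2[0]`, hence the added generator `[0]`. -/
theorem pairing_self_mem (P : PointGroup L) : pairing P P ∈ relationsOrigin L := by
  induction P using Finsupp.induction_linear with
  | zero => simp
  | add P P' h h' =>
    have := add_mem (add_mem h h') (relations_le (pairing_add_swap_mem P P'))
    simp only [map_add, AddMonoidHom.add_apply] at this ⊢
    convert this using 1
    abel
  | single x m =>
    simp only [single_eq_smul_cls, map_zsmul, AddMonoidHom.smul_apply, pairing_cls, sub_self]
    exact Submodule.smul_mem _ _ (Submodule.smul_mem _ _ cls_zero_mem)

/-- Expansion gives `P * Q - P * R - R * Q + R * R`; two swaps turn it into the cyclic sum. This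
identifies a Bloch relation with the symbol of `f` and `1 - f`. -/
theorem pairing_sub_sub_mem_iff (P Q R : PointGroup L) :
    pairing (P - R) (Q - R) ∈ relationsOrigin L ↔ cyclicPairing P Q R ∈ relationsOrigin L := by
  have h := sub_mem (pairing_self_mem R) (add_mem (relations_le (pairing_add_swap_mem P R))
    (relations_le (pairing_add_swap_mem R Q)))
  have heq : pairing (P - R) (Q - R) = cyclicPairing P Q R + (pairing R R -
      (pairing P R + pairing R P + (pairing R Q + pairing Q R))) := by
    simp only [map_sub, AddMonoidHom.sub_apply, cyclicPairing]
    abel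
  rw [heq]
  exact Submodule.add_mem_iff_left _ h

/-- The five-term relation of an alternating biadditive map. -/
theorem alternating_five_term {G V : Type*} [AddCommGroup G] [AddCommGroup V] (b : G →+ G →+ V)
    (hb : ∀ x, b x x = 0) (A B C D E : G) :
    b A B = b C D + b (A - C) (E - C) - b (B - D) (E - D) - b (A + D - C - B) (E - C - B) := by
  have hskew (x y : G) : b x y = -b y x := by
    have := hb (x + y)
    simp only [map_add, AddMonoidHom.add_apply, hb, zero_add, add_zero] at this
    exact eq_neg_of_add_eq_zero_right this
  simp only [map_add, map_sub, AddMonoidHom.add_apply, AddMonoidHom.sub_apply, hb]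
  rw [hskew D B, hskew C B, hskew D C]
  abel

/-- For every function `x` with divisor `A`, the symbol of `x` and `1 - x` is a combination of
relations and the class of the origin. -/
def SteinbergVanishes (A : PointGroup L) : Prop :=
  ∀ (x : ℂ → ℂ) (B : PointGroup L), IsRationalFunction L x → HasDivisor x A →
    HasDivisor (fun z => 1 - x z) B → pairing A B ∈ relationsOrigin L

/-- The divisor `E` of `f - g` suffices to describe all the complements: `1 - f/g = -(f - g)/g`, `1
- (1 - f)/(1 - g) = (f - g)/(1 - g)`, and `1 - f(1 - g)/(g(1 - f)) = -(f - g)/(g(1 - f))`. -/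
theorem pairing_mem_of_five_term {f g : ℂ → ℂ} {A B C D E : PointGroup L}
    (hf : IsRationalFunction L f) (hg : IsRationalFunction L g) (hA : HasDivisor f A)
    (hB : HasDivisor (fun z => 1 - f z) B) (hC : HasDivisor g C)
    (hD : HasDivisor (fun z => 1 - g z) D) (hE : HasDivisor (fun z => f z - g z) E)
    (h₁ : SteinbergVanishes C) (h₂ : SteinbergVanishes (A - C)) (h₃ : SteinbergVanishes (B - D))
    (h₄ : SteinbergVanishes (A + D - C - B)) : pairing A B ∈ relationsOrigin L := by
  have m₁ := h₁ g D hg hC hD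
  have m₂ := h₂ (fun z => f z / g z) (E - C) (hf.div hg) (hA.div hf hg hC)
    ((hE.div (hf.sub hg) hg hC).neg.congr fun z => by
      filter_upwards [hC.eventually_ne_zero hg z] with w hw
      field_simp
      ring)
  have m₃ := h₃ (fun z => (1 - f z) / (1 - g z)) (E - D) (hf.one_sub.div hg.one_sub)
    (hB.div hf.one_sub hg.one_sub hD)
    ((hE.div (hf.sub hg) hg.one_sub hD).congr fun z => by
      filter_upwards [hD.eventually_ne_zero hg.one_sub z] with w hw
      field_simp
      ring)
  have m₄ := h₄ (fun z => f z * (1 - g z) / g z / (1 - f z)) (E - C - B)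
    (((hf.mul hg.one_sub).div hg).div hf.one_sub)
    (((hA.mul hf hg.one_sub hD).div (hf.mul hg.one_sub) hg hC).div
      ((hf.mul hg.one_sub).div hg) hf.one_sub hB)
    (((hE.div (hf.sub hg) hg hC).div ((hf.sub hg).div hg) hf.one_sub hB).neg.congr fun z => by
      filter_upwards [hB.eventually_ne_zero hf.one_sub z, hC.eventually_ne_zero hg z] with w hw hw'
      field_simp
      ring)
  -- In this quotient the pairing is alternating, so the formal five-term identity applies.
  let q : PointGroup L →+ PointGroup L ⧸ relationsOrigin L :=
    (relationsOrigin L).mkQ.toAddMonoidHom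
  have hq (x : PointGroup L) : q x = 0 ↔ x ∈ relationsOrigin L :=
    Submodule.Quotient.mk_eq_zero _
  have key := alternating_five_term (q.compHom.comp pairing)
    (fun x => (hq _).2 (pairing_self_mem x)) A B C D E
  simp only [AddMonoidHom.comp_apply, AddMonoidHom.compHom_apply_apply] at key
  rw [← hq, key, (hq _).2 m₁, (hq _).2 m₂, (hq _).2 m₃, (hq _).2 m₄]
  simp

/-! ### Effective divisors -/

theorem degree_nonneg {P : PointGroup L} (hP : 0 ≤ P) : 0 ≤ Finsupp.degree P := by
  rw [Finsupp.degree_apply]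
  exact Finset.sum_nonneg fun p _ => hP p

theorem degree_mono {P Q : PointGroup L} (h : P ≤ Q) : Finsupp.degree P ≤ Finsupp.degree Q := by
  have := degree_nonneg (sub_nonneg.2 h)
  rwa [map_sub, sub_nonneg] at this

theorem eq_zero_of_degree_eq_zero {P : PointGroup L} (hP : 0 ≤ P) (h : Finsupp.degree P = 0) :
    P = 0 := by
  rw [Finsupp.degree_apply, Finset.sum_eq_zero_iff_of_nonneg fun p _ => hP p] at h
  ext p
  by_contra hp
  exact hp (h p (Finsupp.mem_support_iff.2 hp))

theorem cls_nonneg (p : Curve L) : 0 ≤ cls p := Finsupp.single_nonneg.2 zero_le_one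

@[simp] theorem cls_apply_self (p : Curve L) : cls p p = 1 := by simp [cls]

theorem cls_apply_of_ne {p q : Curve L} (h : p ≠ q) : cls p q = 0 := Finsupp.single_eq_of_ne' h

theorem cls_le_iff {p : Curve L} {P : PointGroup L} (hP : 0 ≤ P) : cls p ≤ P ↔ 0 < P p := by
  constructor
  · intro h
    have := h p
    rw [cls_apply_self] at this
    omega
  · intro h q
    by_cases hq : p = q
    · subst hq; rw [cls_apply_self]; omega
    · rw [cls_apply_of_ne hq]; exact hP q

theorem exists_eq_cls_add {P : PointGroup L} (hP : 0 ≤ P) {n : ℕ}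
    (h : Finsupp.degree P = (n + 1 : ℕ)) :
    ∃ (p : Curve L) (Q : PointGroup L), 0 ≤ Q ∧ Finsupp.degree Q = n ∧ P = cls p + Q := by
  have hne : P ≠ 0 := by
    rintro rfl
    rw [map_zero] at h
    omega
  obtain ⟨p, hp⟩ := Finsupp.ne_iff.1 hne
  have hle : cls p ≤ P := (cls_le_iff hP).2 (lt_of_le_of_ne (hP p) (Ne.symm hp))
  refine ⟨p, P - cls p, sub_nonneg.2 hle, ?_, by abel⟩
  rw [map_sub, h, degree_cls]
  push_cast
  ring

theorem exists_eq_sum_cls {n : ℕ} {P : PointGroup L} (hP : 0 ≤ P) (h : Finsupp.degree P = n) :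
    ∃ p : Fin n → Curve L, P = ∑ i, cls (p i) := by
  induction n generalizing P with
  | zero => exact ⟨Fin.elim0, by simpa using eq_zero_of_degree_eq_zero hP (by simpa using h)⟩
  | succ n ih =>
    obtain ⟨p, Q, hQ, hdeg, rfl⟩ := exists_eq_cls_add hP h
    obtain ⟨q, rfl⟩ := ih hQ hdeg
    exact ⟨Fin.cons p q, by simp [Fin.sum_univ_succ]⟩

theorem sum_cls_nonneg {ι : Type*} (s : Finset ι) (p : ι → Curve L) : 0 ≤ ∑ i ∈ s, cls (p i) :=
  Finset.sum_nonneg fun i _ => cls_nonneg (p i)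

theorem exists_pair_or_eq_smul {P : PointGroup L} (hP : 0 ≤ P) {n : ℕ} (hn : 0 < n)
    (h : Finsupp.degree P = n) :
    (∃ x y, x ≠ y ∧ cls x + cls y ≤ P) ∨ ∃ x, P = (n : ℤ) • cls x := by
  obtain ⟨p, rfl⟩ := exists_eq_sum_cls hP h
  by_cases hp : ∃ i j, p i ≠ p j
  · obtain ⟨i, j, hij⟩ := hp
    refine Or.inl ⟨p i, p j, hij, ?_⟩
    have hne : i ≠ j := fun h => hij (congrArg p h)
    rw [← Finset.sum_pair (f := fun i => cls (p i)) hne]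
    exact Finset.sum_le_sum_of_subset_of_nonneg (Finset.subset_univ _)
      fun i _ _ => cls_nonneg (p i)
  · push Not at hp
    refine Or.inr ⟨p ⟨0, hn⟩, ?_⟩
    rw [Finset.sum_congr rfl fun i _ => by rw [hp i ⟨0, hn⟩]]
    simp

/-! ### Divisors of `f` and `1 - f` -/

/-- Ultrametric comparison of the order of `f` with the order `0` of the constant `1`. -/
theorem HasDivisor.one_sub_apply {f : ℂ → ℂ} {A B : PointGroup L} (hf : IsRationalFunction L f)
    (hA : HasDivisor f A) (hB : HasDivisor (fun z => 1 - f z) B) (x : Curve L) :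
    (A x < 0 → B x = A x) ∧ (0 < A x → B x = 0) ∧ (0 ≤ A x → 0 ≤ B x) := by
  classical
  obtain ⟨z, rfl⟩ := pt_surjective x
  have h1 : meromorphicOrderAt (fun _ : ℂ => (1 : ℂ)) z = ((0 : ℤ) : WithTop ℤ) := by
    rw [meromorphicOrderAt_const, if_neg one_ne_zero]; rfl
  have hneg := hA.neg z
  have hmer : MeromorphicAt (fun z => -f z) z := (hf.1 z).neg
  have hBz := hB z
  have heq : (fun z => 1 - f z) = (fun _ => 1) + fun z => -f z := by
    ext z; simp [sub_eq_add_neg]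
  rw [heq] at hBz
  refine ⟨fun h => ?_, fun h => ?_, fun h => ?_⟩
  · rw [meromorphicOrderAt_add_eq_right_of_lt (.const 1 z), hneg] at hBz
    · exact_mod_cast hBz.symm
    · rw [h1, hneg]; exact_mod_cast h
  · rw [meromorphicOrderAt_add_eq_left_of_lt hmer, h1] at hBz
    · exact_mod_cast hBz.symm
    · rw [h1, hneg]; exact_mod_cast h
  · have := meromorphicOrderAt_add (f₁ := fun _ : ℂ => (1 : ℂ)) (.const 1 z) hmer
    rw [h1, hneg, hBz] at this
    have h2 : min 0 (A (pt L z)) ≤ B (pt L z) := by exact_mod_cast this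
    rwa [min_eq_left h] at h2

/-- The effective divisors `P`, `Q`, `R` of degree `n` are the fibres of `f` over `0, 1, ∞`. -/
structure IsFibreTriple (f : ℂ → ℂ) (P Q R : PointGroup L) (n : ℕ) : Prop where
  rational : IsRationalFunction L f
  nonneg₀ : 0 ≤ P
  nonneg₁ : 0 ≤ Q
  nonneg_top : 0 ≤ R
  degree₀ : Finsupp.degree P = n
  degree₁ : Finsupp.degree Q = n
  degree_top : Finsupp.degree R = n
  disjoint₀₁ : ∀ x, P x = 0 ∨ Q x = 0
  disjoint₁_top : ∀ x, Q x = 0 ∨ R x = 0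
  disjoint_top₀ : ∀ x, R x = 0 ∨ P x = 0
  divisor₀ : HasDivisor f (P - R)
  divisor₁ : HasDivisor (fun z => 1 - f z) (Q - R)

end

section

/-! ### Fibre triples -/

section

variable {L : PeriodPair}

/-- The positive part of a divisor. -/
def posDivisor (A : PointGroup L) : PointGroup L := A.mapRange (fun m => max m 0) rfl

@[simp] theorem posDivisor_apply (A : PointGroup L) (x : Curve L) :
    posDivisor A x = max (A x) 0 := Finsupp.mapRange_apply

theorem posDivisor_nonneg (A : PointGroup L) : 0 ≤ posDivisor A := fun x => by simp

theorem posDivisor_le {A S : PointGroup L} (h : A ≤ S) (hS : 0 ≤ S) : posDivisor A ≤ S :=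
  fun x => by
    rw [posDivisor_apply]
    exact max_le (h x) (hS x)

theorem posDivisor_sub (A : PointGroup L) : posDivisor A - posDivisor (-A) = A := by
  ext x
  simp only [Finsupp.sub_apply, posDivisor_apply, Finsupp.neg_apply]
  omega

theorem posDivisor_disjoint (A : PointGroup L) (x : Curve L) :
    posDivisor (-A) x = 0 ∨ posDivisor A x = 0 := by
  simp only [posDivisor_apply, Finsupp.neg_apply]
  omega

theorem degree_posDivisor (A : PointGroup L) :
    Finsupp.degree (posDivisor A) = A.sum fun _ m => max m 0 := by
  rw [Finsupp.degree_apply, ← Finsupp.sum_mapRange_index (h := fun _ m => m) (hf := rfl)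
    (f := fun m : ℤ => max m 0) fun _ => rfl]
  rfl

namespace IsFibreTriple

variable {f : ℂ → ℂ} {P Q R : PointGroup L} {n : ℕ}

theorem cyclicPairing_mem_iff {M : Submodule ℤ (PointGroup L)} :
    cyclicPairing Q R P ∈ M ↔ cyclicPairing P Q R ∈ M := by
  rw [show cyclicPairing Q R P = cyclicPairing P Q R by simp only [cyclicPairing]; abel]

/-- Modulo antisymmetry a transposition changes the sign of the cyclic sum. With the rotation above,
membership is invariant under all permutations of the three fibres. -/
theorem cyclicPairing_swap_mem_iff :
    cyclicPairing Q P R ∈ relationsOrigin L ↔ cyclicPairing P Q R ∈ relationsOrigin L := by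
  have h := add_mem (add_mem (relations_le (pairing_add_swap_mem P Q))
    (relations_le (pairing_add_swap_mem Q R))) (relations_le (pairing_add_swap_mem R P))
  have heq : cyclicPairing Q P R = (pairing P Q + pairing Q P + (pairing Q R + pairing R Q) +
      (pairing R P + pairing P R)) - cyclicPairing P Q R := by
    simp only [cyclicPairing]; abel
  rw [heq]
  exact Submodule.sub_mem_iff_right _ h

theorem one_sub (h : IsFibreTriple f P Q R n) : IsFibreTriple (fun z => 1 - f z) Q P R n where
  rational := h.rational.one_sub
  nonneg₀ := h.nonneg₁
  nonneg₁ := h.nonneg₀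
  nonneg_top := h.nonneg_top
  degree₀ := h.degree₁
  degree₁ := h.degree₀
  degree_top := h.degree_top
  disjoint₀₁ x := (h.disjoint₀₁ x).symm
  disjoint₁_top x := (h.disjoint_top₀ x).symm
  disjoint_top₀ x := (h.disjoint₁_top x).symm
  divisor₀ := h.divisor₁
  divisor₁ := by simpa using h.divisor₀

theorem rotate (h : IsFibreTriple f P Q R n) :
    IsFibreTriple (fun z => 1 - (f z)⁻¹) Q R P n where
  rational := h.rational.inv.one_sub
  nonneg₀ := h.nonneg₁
  nonneg₁ := h.nonneg_top
  nonneg_top := h.nonneg₀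
  degree₀ := h.degree₁
  degree₁ := h.degree_top
  degree_top := h.degree₀
  disjoint₀₁ := h.disjoint₁_top
  disjoint₁_top := h.disjoint_top₀
  disjoint_top₀ := h.disjoint₀₁
  divisor₀ := by
    have := (h.divisor₁.div h.rational.one_sub h.rational h.divisor₀).neg
    rw [sub_sub_sub_cancel_right] at this
    refine this.congr fun z => ?_
    filter_upwards [h.divisor₀.eventually_ne_zero h.rational z] with w hw
    field_simp
    ring
  divisor₁ := by simpa using h.divisor₀.inv

end IsFibreTriple

/-- The poles of `1 - f` are those of `f`. Here `Z` and `W` may overlap, so that `D + W` can stand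
for the fibre over `1` before common zeros and poles are cancelled. -/
theorem HasDivisor.one_sub_add_nonneg {f : ℂ → ℂ} {Z W D : PointGroup L}
    (hf : IsRationalFunction L f) (hZ : 0 ≤ Z) (hW : 0 ≤ W) (h : HasDivisor f (Z - W))
    (hD : HasDivisor (fun z => 1 - f z) D) : 0 ≤ D + W := fun x => by
  obtain ⟨h1, -, h3⟩ := HasDivisor.one_sub_apply hf h hD x
  simp only [Finsupp.sub_apply, Finsupp.add_apply, Finsupp.zero_apply] at h1 h3 ⊢
  have := hZ x
  have := hW x
  simp only [Finsupp.zero_apply] at *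
  omega

/-- The relation of every function of degree `n` is a combination of relations and the class of
the origin. -/
def RelationsVanish (L : PeriodPair) (n : ℕ) : Prop :=
  ∀ (f : ℂ → ℂ) (P Q R : PointGroup L), IsFibreTriple f P Q R n →
    cyclicPairing P Q R ∈ relationsOrigin L

/-- An elliptic function with zero order at a point can be rescaled to take the value `1` there. -/
theorem HasDivisor.exists_normalized {f : ℂ → ℂ} {C : PointGroup L} (hf : IsRationalFunction L f)
    (hC : HasDivisor f C) {x : Curve L} (hx : C x = 0) :
    ∃ k : ℂ, k ≠ 0 ∧ IsRationalFunction L (fun z => k * f z) ∧ HasDivisor (fun z => k * f z) C ∧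
      ∀ D : PointGroup L, HasDivisor (fun z => 1 - k * f z) D → 0 < D x := by
  obtain ⟨z, rfl⟩ := pt_surjective x
  obtain ⟨c, hc, hlim⟩ := tendsto_ne_zero_of_meromorphicOrderAt_eq_zero (hf.1 z)
    (by rw [hC z, hx]; rfl)
  have hrat := (IsRationalFunction.const L c⁻¹).mul hf
  refine ⟨c⁻¹, inv_ne_zero hc, hrat, ?_, fun D hD => ?_⟩
  · simpa using (HasDivisor.const (L := L) (inv_ne_zero hc)).mul (.const L _) hf hC
  · have h0 : Tendsto (fun z => 1 - c⁻¹ * f z) (𝓝[≠] z) (𝓝 0) := by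
      have := (hlim.const_mul c⁻¹).const_sub 1
      rwa [inv_mul_cancel₀ hc, sub_self] at this
    have := (tendsto_zero_iff_meromorphicOrderAt_pos (hrat.one_sub.1 z)).1 h0
    rw [hD z] at this
    exact_mod_cast this

end

/-! ### Lowering the degree with a function that shares points with `f` -/

variable {τ : ℂ} {hτ : τ.im ≠ 0}

theorem isFibreTriple_of_hasDivisor {f : ℂ → ℂ} {P R B : PointGroup (periods τ hτ)} {n : ℕ}
    (hf : IsRationalFunction (periods τ hτ) f) (hP : 0 ≤ P) (hR : 0 ≤ R)
    (hPR : ∀ x, R x = 0 ∨ P x = 0) (hA : HasDivisor f (P - R))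
    (hB : HasDivisor (fun z => 1 - f z) B) (hn : Finsupp.degree P = n) :
    IsFibreTriple f P (B + R) R n := by
  have dA := (hA.degree_and_pointSum hf).1
  have dB := (hB.degree_and_pointSum hf.one_sub).1
  rw [map_sub, sub_eq_zero, hn] at dA
  refine ⟨hf, hP, HasDivisor.one_sub_add_nonneg hf hP hR hA hB, hR, hn,
    by rw [map_add, dB, ← dA, zero_add], dA.symm, fun x => ?_, fun x => ?_, hPR, hA,
    by simpa using hB⟩
  all_goals
    obtain ⟨h1, h2, -⟩ := HasDivisor.one_sub_apply hf hA hB x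
    have h3 := hPR x
    have h4 := hP x
    have h5 := hR x
    simp only [Finsupp.sub_apply, Finsupp.add_apply, Finsupp.zero_apply] at *
    omega

theorem SteinbergVanishes.of_disjoint {P R : PointGroup (periods τ hτ)} {n : ℕ} (hP : 0 ≤ P)
    (hR : 0 ≤ R) (hPR : ∀ x, R x = 0 ∨ P x = 0) (hn : Finsupp.degree P = n)
    (h : RelationsVanish (periods τ hτ) n) : SteinbergVanishes (P - R) := fun x B hx hA hB => by
  have := h _ _ _ _ (isFibreTriple_of_hasDivisor hx hP hR hPR hA hB hn)
  rw [← pairing_sub_sub_mem_iff] at this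
  simpa using this

/-- The degree of a function is that of the positive part of its divisor, which any effective
divisor above it bounds. -/
theorem SteinbergVanishes.of_le {A S : PointGroup (periods τ hτ)} {n : ℕ}
    (ih : ∀ k < n, RelationsVanish (periods τ hτ) k) (hAS : A ≤ S) (hS : 0 ≤ S)
    (hn : Finsupp.degree S < n) : SteinbergVanishes A := by
  have hle := degree_mono (posDivisor_le hAS hS)
  obtain ⟨k, hk⟩ := Int.eq_ofNat_of_zero_le (degree_nonneg (posDivisor_nonneg A))
  rw [← posDivisor_sub A]
  exact SteinbergVanishes.of_disjoint (posDivisor_nonneg _) (posDivisor_nonneg _)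
    (posDivisor_disjoint A) hk (ih k (by omega))

/-- If some function `g` of smaller degree shares enough zeros, poles and `1`-points with `f`, the
relation of `f` follows from relations of smaller degree. -/
theorem IsFibreTriple.mem_of_common_points {f g : ℂ → ℂ}
    {P Q R Z W D K₀ K₁ K : PointGroup (periods τ hτ)} {n m : ℕ} (hT : IsFibreTriple f P Q R n)
    (ih : ∀ k < n, RelationsVanish (periods τ hτ) k) (hg : IsRationalFunction (periods τ hτ) g)
    (hZ : 0 ≤ Z) (hW : 0 ≤ W) (hC : HasDivisor g (Z - W))
    (hD : HasDivisor (fun z => 1 - g z) D) (hm : Finsupp.degree Z = m) (hmn : m < n)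
    (hK₀P : K₀ ≤ P) (hK₀Z : K₀ ≤ Z) (hK₁Q : K₁ ≤ Q) (hK₁D : K₁ ≤ D + W) (hKR : K ≤ R)
    (hKW : K ≤ W) (h₀₁ : m < Finsupp.degree K₀ + Finsupp.degree K₁)
    (h₁ : m < Finsupp.degree K₁ + Finsupp.degree K)
    (h₀ : m < Finsupp.degree K + Finsupp.degree K₀) : cyclicPairing P Q R ∈ relationsOrigin _ := by
  have dC := (hC.degree_and_pointSum hg).1
  have dD := (hD.degree_and_pointSum hg.one_sub).1
  rw [map_sub, sub_eq_zero, hm] at dC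
  -- Equality would give `P ≤ Z`, since `P` and `R` are disjoint, against `m < n`. It ensures that
  -- `f - g` is not identically zero.
  have hne : P - R ≠ Z - W := by
    intro h
    have hPZ : P ≤ Z := fun x => by
      have h1 := DFunLike.congr_fun h x
      have h2 := hT.disjoint_top₀ x
      have h3 := hT.nonneg_top x
      have h4 := hZ x
      have h5 := hW x
      simp only [Finsupp.sub_apply, Finsupp.zero_apply] at *
      omega
    have := degree_mono hPZ
    rw [hT.degree₀, hm] at this
    omega
  obtain ⟨E, hE⟩ := HasDivisor.exists_sub hT.rational hg hT.divisor₀ hC hne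
  rw [← pairing_sub_sub_mem_iff]
  -- Without cancellation the last three functions have degree at most `n + m`. Common points
  -- subtract the degrees of `K₀` and `K` from `f / g`, of `K₁` and `K` from `(1 - f) / (1 - g)`,
  -- and of `K₀` and `K₁` from the last quotient.
  refine pairing_mem_of_five_term hT.rational hg hT.divisor₀ hT.divisor₁ hC hD hE
    (.of_le ih (sub_le_self Z hW) hZ (by rw [hm]; omega))
    (.of_le ih (S := (P - K₀) + (W - K)) ?_ ?_ ?_) (.of_le ih (S := (Q - K₁) + (W - K)) ?_ ?_ ?_)
    (.of_le ih (S := (P - K₀) + (D + W - K₁)) ?_ ?_ ?_)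
  · calc P - R - (Z - W) = P + W - (Z + R) := by abel
      _ ≤ P + W - (K₀ + K) := sub_le_sub_left (add_le_add hK₀Z hKR) _
      _ = _ := by abel
  · exact add_nonneg (sub_nonneg.2 hK₀P) (sub_nonneg.2 hKW)
  · rw [map_add, map_sub, map_sub, hT.degree₀, ← dC]; omega
  · calc Q - R - D = Q + W - (D + W + R) := by abel
      _ ≤ Q + W - (K₁ + K) := sub_le_sub_left (add_le_add hK₁D hKR) _
      _ = _ := by abel
  · exact add_nonneg (sub_nonneg.2 hK₁Q) (sub_nonneg.2 hKW)
  · rw [map_add, map_sub, map_sub, hT.degree₁, ← dC]; omega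
  · calc P - R + D - (Z - W) - (Q - R) = P + (D + W) - (Z + Q) := by abel
      _ ≤ P + (D + W) - (K₀ + K₁) := sub_le_sub_left (add_le_add hK₀Z hK₁Q) _
      _ = _ := by abel
  · exact add_nonneg (sub_nonneg.2 hK₀P) (sub_nonneg.2 hK₁D)
  · rw [map_add, map_sub, map_sub, map_add, hT.degree₀, ← dC, dD]; omega

/-- A function of degree at least four is not totally ramified over `0`, `1` and `∞`. -/
theorem IsFibreTriple.not_totally_ramified {f : ℂ → ℂ} {a b c : Curve (periods τ hτ)} {n : ℕ}
    (hn : 4 ≤ n) (hT : IsFibreTriple f ((n : ℤ) • cls a) ((n : ℤ) • cls b) ((n : ℤ) • cls c) n) :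
    False := by
  have ne_of (x y : Curve (periods τ hτ))
      (h : ∀ p, ((n : ℤ) • cls x) p = 0 ∨ ((n : ℤ) • cls y) p = 0) : x ≠ y := by
    rintro rfl
    have := h x
    simp at this
    omega
  have hab := ne_of a b hT.disjoint₀₁
  have hbc := ne_of b c hT.disjoint₁_top
  have hca := ne_of c a hT.disjoint_top₀
  have hf := hT.rational
  have hder : IsRationalFunction (periods τ hτ) (deriv f) := by
    refine ⟨hf.1.deriv, fun l hl z => ?_⟩
    rw [← deriv_comp_add_const, funext (hf.2 l hl)]
  have hlog : IsRationalFunction (periods τ hτ) (logDeriv f) := hder.div hf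
  -- Riemann-Hurwitz for the differential `df / (f (1 - f))`: it has order `n - 1` at `c`, order
  -- `-1` at `a` and `b`, and no other poles. Its degree is zero, so `n - 3 ≤ 0`.
  set w : ℂ → ℂ := fun z => logDeriv f z / (1 - f z) with hw
  have hwr : IsRationalFunction (periods τ hτ) w := hlog.div hf.one_sub
  have hord (z : ℂ) : meromorphicOrderAt w z =
      meromorphicOrderAt (logDeriv f) z - meromorphicOrderAt (fun z => 1 - f z) z :=
    fun_meromorphicOrderAt_div (hlog.1 z) (hf.one_sub.1 z)
  -- The same function through the logarithmic derivative of `1 - f`, which reveals the order at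
  -- `b`.
  have hord' (z : ℂ) : meromorphicOrderAt w z =
      meromorphicOrderAt (logDeriv fun z => 1 - f z) z - meromorphicOrderAt f z := by
    have hlog' : MeromorphicAt (logDeriv fun z => 1 - f z) z :=
      (hf.one_sub.1 z).deriv.div (hf.one_sub.1 z)
    rw [← fun_meromorphicOrderAt_div hlog' (hf.1 z),
      meromorphicOrderAt_fun_neg (f := fun w => logDeriv (fun z => 1 - f z) w / f w)]
    refine meromorphicOrderAt_congr ?_
    filter_upwards [self_mem_nhdsWithin] with w _
    simp only [hw, logDeriv_apply, deriv_const_sub]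
    ring
  have hlogne (z : ℂ) (h : ((n : ℤ) • cls a - (n : ℤ) • cls c) (pt _ z) ≠ 0) :
      meromorphicOrderAt w z = ((-1 - ((n : ℤ) • cls b - (n : ℤ) • cls c) (pt _ z) : ℤ) :
        WithTop ℤ) := by
    rw [hord, hT.divisor₁ z, meromorphicOrderAt_logDeriv_eq_neg_one (hf.1 z)
      (by rw [hT.divisor₀ z]; exact_mod_cast h) (hT.divisor₀.order_ne_top z)]
    rfl
  have hwc : meromorphicOrderAt w (rep c) = ((n - 1 : ℤ) : WithTop ℤ) := by
    rw [hlogne]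
    · congr 1
      simp [cls_apply_of_ne hbc]
      ring
    · simp [cls_apply_of_ne hca.symm]
      omega
  obtain ⟨W, hW⟩ := hwr.exists_hasDivisor (z := rep c) (by rw [hwc]; exact WithTop.coe_ne_top)
  have hle : (n - 1 : ℤ) • cls c - cls a - cls b ≤ W := fun x => by
    by_cases hxc : x = c
    · subst hxc
      have := (hW (rep x)).symm.trans hwc
      rw [pt_rep] at this
      have : W x = (n - 1 : ℤ) := by exact_mod_cast this
      simp [cls_apply_of_ne hca.symm, cls_apply_of_ne hbc, this]
    · by_cases hxa : x = a
      · subst hxa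
        have := (hW (rep x)).symm.trans (hlogne _ (by
          simp [cls_apply_of_ne hca]; omega))
        rw [pt_rep] at this
        have h2 := WithTop.coe_injective this
        simp [cls_apply_of_ne hca, cls_apply_of_ne hab.symm] at h2 ⊢
        omega
      · have hA0 : ((n : ℤ) • cls a - (n : ℤ) • cls c) x = 0 := by
          simp [cls_apply_of_ne (Ne.symm hxa), cls_apply_of_ne (Ne.symm hxc)]
        have hf0 : meromorphicOrderAt f (rep x) = 0 := by
          rw [hT.divisor₀, pt_rep, hA0]; rfl
        by_cases hxb : x = b
        · subst hxb
          have h3 := hord' (rep x)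
          rw [meromorphicOrderAt_logDeriv_eq_neg_one (hf.one_sub.1 _) (by
            rw [hT.divisor₁, pt_rep]
            have : ((n : ℤ) • cls x - (n : ℤ) • cls c) x ≠ 0 := by
              simp [cls_apply_of_ne (Ne.symm hxc)]; omega
            exact_mod_cast this) (hT.divisor₁.order_ne_top _), hf0, hW, pt_rep] at h3
          have h4 : W x = -1 := WithTop.coe_injective (h3.trans rfl)
          simp [cls_apply_of_ne (Ne.symm hxc), cls_apply_of_ne hab, h4]
        · have h3 := meromorphicOrderAt_logDeriv_nonneg (hf.1 (rep x)) hf0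
          have hB0 : ((n : ℤ) • cls b - (n : ℤ) • cls c) x = 0 := by
            simp [cls_apply_of_ne (Ne.symm hxb), cls_apply_of_ne (Ne.symm hxc)]
          have h4 := hord (rep x)
          rw [hT.divisor₁, pt_rep, hB0, hW, pt_rep] at h4
          have h5 : ((W x : ℤ) : WithTop ℤ) = meromorphicOrderAt (logDeriv f) (rep x) :=
            h4.trans (by simp)
          rw [← h5] at h3
          have h6 : 0 ≤ W x := by exact_mod_cast h3
          simp [cls_apply_of_ne (Ne.symm hxb), cls_apply_of_ne (Ne.symm hxc),
            cls_apply_of_ne (Ne.symm hxa), h6]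
  have := degree_mono hle
  rw [(hW.degree_and_pointSum hwr).1] at this
  simp at this
  omega

end

/-! ### Interpolation by theta quotients and the case of degree at least four -/

section

variable {τ : ℂ} {hτ : τ.im ≠ 0}

namespace ThetaFunction

variable (θ : ThetaFunction τ)

theorem rational_quotient {a₁ a₂ a₃ c₁ c₂ c₃ : ℂ} (h : a₁ + a₂ + a₃ = c₁ + c₂ + c₃) :
    IsRationalFunction (periods τ hτ) fun z =>
      θ.toFun (z - a₁) * θ.toFun (z - a₂) * θ.toFun (z - a₃) /
        (θ.toFun (z - c₁) * θ.toFun (z - c₂) * θ.toFun (z - c₃)) := by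
  have hmer (a z : ℂ) : MeromorphicAt (fun z => θ.toFun (z - a)) z := by
    simpa using θ.meromorphic_factor a 1 z
  refine ⟨fun z => (((hmer _ z).mul (hmer _ z)).mul (hmer _ z)).div
    (((hmer _ z).mul (hmer _ z)).mul (hmer _ z)), periodic_of_mem_periods (fun z => ?_)
    (fun z => ?_)⟩
  · simp only [add_sub_right_comm, θ.add_one]
  · simp only [add_sub_right_comm, θ.add_period]
    have hexp : exp (θ.κ * (z - a₁) + θ.c) * exp (θ.κ * (z - a₂) + θ.c) *
        exp (θ.κ * (z - a₃) + θ.c) = exp (θ.κ * (z - c₁) + θ.c) * exp (θ.κ * (z - c₂) + θ.c) *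
        exp (θ.κ * (z - c₃) + θ.c) := by
      simp only [← exp_add]
      congr 1
      linear_combination -θ.κ * h
    have hsplit {p q r x y w : ℂ} : p * x * (q * y) * (r * w) = p * q * r * (x * y * w) := by ring
    rw [hsplit, hsplit, hexp, mul_div_mul_left _ _ (by simp [exp_ne_zero])]

theorem hasDivisor_quotient (a₁ a₂ a₃ c₁ c₂ c₃ : ℂ) :
    HasDivisor (L := periods τ hτ) (fun z =>
      θ.toFun (z - a₁) * θ.toFun (z - a₂) * θ.toFun (z - a₃) /
        (θ.toFun (z - c₁) * θ.toFun (z - c₂) * θ.toFun (z - c₃)))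
      (cls (pt _ a₁) + cls (pt _ a₂) + cls (pt _ a₃) -
        (cls (pt _ c₁) + cls (pt _ c₂) + cls (pt _ c₃))) := fun z => by
  have hmer (a : ℂ) : MeromorphicAt (fun z => θ.toFun (z - a)) z := by
    simpa using θ.meromorphic_factor a 1 z
  have hmer₃ (a b c : ℂ) :
      MeromorphicAt (fun z => θ.toFun (z - a) * θ.toFun (z - b) * θ.toFun (z - c)) z :=
    ((hmer a).mul (hmer b)).mul (hmer c)
  have hord (a b c : ℂ) :
      meromorphicOrderAt (fun z => θ.toFun (z - a) * θ.toFun (z - b) * θ.toFun (z - c)) z =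
      (((cls (pt (periods τ hτ) a) + cls (pt (periods τ hτ) b) + cls (pt (periods τ hτ) c))
        (pt (periods τ hτ) z) : ℤ) : WithTop ℤ) := by
    rw [fun_meromorphicOrderAt_mul (f := fun z => θ.toFun (z - a) * θ.toFun (z - b))
        ((hmer a).mul (hmer b)) (hmer c), fun_meromorphicOrderAt_mul (hmer a) (hmer b)]
    simp only [θ.order_sub hτ]
    rfl
  rw [fun_meromorphicOrderAt_div (hmer₃ _ _ _) (hmer₃ _ _ _), hord, hord]
  rfl

/-- The parameter of a third pole for which a function with two further prescribed poles and two
prescribed zeros takes equal values at two points. -/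
theorem exists_balanced (hτ : τ.im ≠ 0) {b₁ b₂ t k₁ k₂ : ℂ} (hk₁ : k₁ ≠ 0) (hk₂ : k₂ ≠ 0)
    (hb : pt (periods τ hτ) b₁ ≠ pt (periods τ hτ) b₂) (ht : pt (periods τ hτ) t ≠ 0) :
    ∃ e, k₁ * (θ.toFun (b₁ - (e + t)) / θ.toFun (b₁ - e)) =
        k₂ * (θ.toFun (b₂ - (e + t)) / θ.toFun (b₂ - e)) ∧
      θ.toFun (b₁ - (e + t)) ≠ 0 ∧ θ.toFun (b₂ - (e + t)) ≠ 0 ∧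
      θ.toFun (b₁ - e) ≠ 0 ∧ θ.toFun (b₂ - e) ≠ 0 := by
  -- The required equality with denominators cleared: an entire function of the free pole `e`.
  set Ψ : ℂ → ℂ := fun e => k₁ * (θ.toFun (b₁ - (e + t)) * θ.toFun (b₂ - e)) -
    k₂ * (θ.toFun (b₂ - (e + t)) * θ.toFun (b₁ - e)) with hΨ
  have hzero : ∃ e, Ψ e = 0 := by
    by_contra hcon
    push Not at hcon
    have hd : Differentiable ℂ Ψ := by
      have := θ.differentiable
      fun_prop
    have sub_one (z : ℂ) : θ.toFun (z - 1) = θ.toFun z := by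
      have := θ.add_one (z - 1)
      rwa [sub_add_cancel, eq_comm] at this
    have sub_period (z : ℂ) : θ.toFun (z - τ) = exp (-(θ.κ * (z - τ) + θ.c)) * θ.toFun z := by
      have := θ.add_period (z - τ)
      rw [sub_add_cancel] at this
      rw [this, ← mul_assoc, ← exp_add]
      simp
    -- Each term of `Ψ` is a product of two theta factors, so the multiplier has exponent `2κ e +
    -- const`. Without zeros this would force `2κ = 0`.
    obtain ⟨hA, -⟩ := multiplier_of_nonvanishing hτ hd hcon
      (A := 2 * θ.κ) (B := θ.κ * (2 * τ + t - b₁ - b₂) - 2 * θ.c)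
      (fun e => by
        simp only [hΨ]
        rw [show b₁ - (e + 1 + t) = b₁ - (e + t) - 1 by ring, show b₂ - (e + 1) = b₂ - e - 1 by ring,
          show b₂ - (e + 1 + t) = b₂ - (e + t) - 1 by ring, show b₁ - (e + 1) = b₁ - e - 1 by ring]
        simp only [sub_one])
      (fun e => by
        simp only [hΨ]
        rw [show b₁ - (e + τ + t) = b₁ - (e + t) - τ by ring, show b₂ - (e + τ) = b₂ - e - τ by ring,
          show b₂ - (e + τ + t) = b₂ - (e + t) - τ by ring, show b₁ - (e + τ) = b₁ - e - τ by ring]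
        simp only [sub_period]
        have h1 : exp (-(θ.κ * (b₁ - (e + t) - τ) + θ.c)) * exp (-(θ.κ * (b₂ - e - τ) + θ.c)) =
            exp (2 * θ.κ * e + (θ.κ * (2 * τ + t - b₁ - b₂) - 2 * θ.c)) := by
          rw [← exp_add]; congr 1; ring
        have h2 : exp (-(θ.κ * (b₂ - (e + t) - τ) + θ.c)) * exp (-(θ.κ * (b₁ - e - τ) + θ.c)) =
            exp (2 * θ.κ * e + (θ.κ * (2 * τ + t - b₁ - b₂) - 2 * θ.c)) := by
          rw [← exp_add]; congr 1; ring
        linear_combination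
          k₁ * (θ.toFun (b₁ - (e + t)) * θ.toFun (b₂ - e)) * h1 -
          k₂ * (θ.toFun (b₂ - (e + t)) * θ.toFun (b₁ - e)) * h2)
    exact θ.κ_ne_zero (by simpa using hA)
  obtain ⟨e, he⟩ := hzero
  rw [hΨ, sub_eq_zero] at he
  have hz (z : ℂ) : θ.toFun z = 0 ↔ pt (periods τ hτ) z = 0 := θ.eq_zero_iff hτ
  have hxy (x y : ℂ) : ¬(θ.toFun (x - (e + t)) = 0 ∧ θ.toFun (x - e) = 0) := by
    rintro ⟨h1, h2⟩
    rw [hz] at h1 h2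
    refine ht ?_
    rw [show t = (x - e) - (x - (e + t)) by ring, pt_sub, h1, h2, sub_zero]
  have hbe (s : ℂ) : ¬(θ.toFun (b₁ - s) = 0 ∧ θ.toFun (b₂ - s) = 0) := by
    rintro ⟨h1, h2⟩
    rw [hz] at h1 h2
    refine hb (sub_eq_zero.1 ?_)
    rw [← pt_sub, show b₁ - b₂ = (b₁ - s) - (b₂ - s) by ring, pt_sub, h1, h2, sub_zero]
  -- At a zero of `Ψ`, a vanishing factor on one side forces one on the other side. Every such pair
  -- is excluded by `t ∉ Λ` or by `b₁ ≠ b₂` on `E`, so no factor vanishes and division is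
  -- legitimate.
  have hiff : (θ.toFun (b₁ - (e + t)) = 0 ∨ θ.toFun (b₂ - e) = 0) ↔
      (θ.toFun (b₂ - (e + t)) = 0 ∨ θ.toFun (b₁ - e) = 0) := by
    have h1 : k₁ * (θ.toFun (b₁ - (e + t)) * θ.toFun (b₂ - e)) = 0 ↔
      k₂ * (θ.toFun (b₂ - (e + t)) * θ.toFun (b₁ - e)) = 0 := by rw [he]
    simpa [hk₁, hk₂] using h1
  have x1 := hxy b₁
  have x2 := hxy b₂
  have x3 := hbe e
  have x4 := hbe (e + t)
  have n1 : θ.toFun (b₁ - (e + t)) ≠ 0 := by tauto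
  have n2 : θ.toFun (b₂ - (e + t)) ≠ 0 := by tauto
  have n3 : θ.toFun (b₁ - e) ≠ 0 := by tauto
  have n4 : θ.toFun (b₂ - e) ≠ 0 := by tauto
  refine ⟨e, ?_, n1, n2, n3, n4⟩
  rw [← mul_div_assoc, ← mul_div_assoc, div_eq_div_iff n3 n4]
  linear_combination he

end ThetaFunction

/-- A function of degree at most three with two prescribed zeros, two prescribed poles and
value `1` at two further points. -/
theorem exists_interpolating {a₁ a₂ c₁ c₂ b₁ b₂ : Curve (periods τ hτ)} (hb : b₁ ≠ b₂)
    (ht : c₁ + c₂ ≠ a₁ + a₂) (hb₁ : b₁ ≠ a₁ ∧ b₁ ≠ a₂ ∧ b₁ ≠ c₁ ∧ b₁ ≠ c₂)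
    (hb₂ : b₂ ≠ a₁ ∧ b₂ ≠ a₂ ∧ b₂ ≠ c₁ ∧ b₂ ≠ c₂) :
    ∃ (g : ℂ → ℂ) (a c : Curve (periods τ hτ)), IsRationalFunction (periods τ hτ) g ∧
      HasDivisor g (cls a₁ + cls a₂ + cls a - (cls c₁ + cls c₂ + cls c)) ∧
      ∀ D : PointGroup (periods τ hτ), HasDivisor (fun z => 1 - g z) D → 0 < D b₁ ∧ 0 < D b₂ := by
  obtain ⟨a₁, rfl⟩ := pt_surjective a₁
  obtain ⟨a₂, rfl⟩ := pt_surjective a₂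
  obtain ⟨c₁, rfl⟩ := pt_surjective c₁
  obtain ⟨c₂, rfl⟩ := pt_surjective c₂
  obtain ⟨b₁, rfl⟩ := pt_surjective b₁
  obtain ⟨b₂, rfl⟩ := pt_surjective b₂
  obtain ⟨θ⟩ := nonempty_thetaFunction hτ
  have hne {x y : ℂ} (h : pt (periods τ hτ) x ≠ pt (periods τ hτ) y) : θ.toFun (x - y) ≠ 0 := by
    rwa [ne_eq, θ.eq_zero_iff hτ, pt_sub, sub_eq_zero]
  -- With third pole `e` and third zero `e + t` the zeros and poles have equal sums. The constants
  -- `k₁`, `k₂` are the values at `b₁`, `b₂` of the part already prescribed.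
  obtain ⟨e, he, n1, n2, n3, n4⟩ := θ.exists_balanced hτ
    (k₁ := θ.toFun (b₁ - a₁) * θ.toFun (b₁ - a₂) / (θ.toFun (b₁ - c₁) * θ.toFun (b₁ - c₂)))
    (k₂ := θ.toFun (b₂ - a₁) * θ.toFun (b₂ - a₂) / (θ.toFun (b₂ - c₁) * θ.toFun (b₂ - c₂)))
    (div_ne_zero (mul_ne_zero (hne hb₁.1) (hne hb₁.2.1))
      (mul_ne_zero (hne hb₁.2.2.1) (hne hb₁.2.2.2)))
    (div_ne_zero (mul_ne_zero (hne hb₂.1) (hne hb₂.2.1))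
      (mul_ne_zero (hne hb₂.2.2.1) (hne hb₂.2.2.2))) hb
    (t := c₁ + c₂ - (a₁ + a₂)) (by rw [pt_sub, pt_add, pt_add]; exact sub_ne_zero.2 ht)
  set t := c₁ + c₂ - (a₁ + a₂) with ht_def
  set h : ℂ → ℂ := fun z => θ.toFun (z - a₁) * θ.toFun (z - a₂) * θ.toFun (z - (e + t)) /
        (θ.toFun (z - c₁) * θ.toFun (z - c₂) * θ.toFun (z - e)) with hdef
  have hh : h b₁ = h b₂ := by
    simpa only [div_mul_div_comm] using he
  have hh0 : h b₁ ≠ 0 := div_ne_zero (mul_ne_zero (mul_ne_zero (hne hb₁.1) (hne hb₁.2.1)) n1)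
    (mul_ne_zero (mul_ne_zero (hne hb₁.2.2.1) (hne hb₁.2.2.2)) n3)
  have hrat : IsRationalFunction (periods τ hτ) h :=
    θ.rational_quotient (by rw [ht_def]; ring)
  have hdiv := θ.hasDivisor_quotient (hτ := hτ) a₁ a₂ (e + t) c₁ c₂ e
  have hgrat := (IsRationalFunction.const _ (h b₁)⁻¹).mul hrat
  refine ⟨fun z => (h b₁)⁻¹ * h z, pt _ (e + t), pt _ e, hgrat, ?_, fun D hD => ?_⟩
  · simpa using (HasDivisor.const (inv_ne_zero hh0)).mul (.const _ _) hrat hdiv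
  · have key (b : ℂ) (hb : h b = h b₁) (hc : ContinuousAt h b) : 0 < D (pt _ b) := by
      have h0 : Tendsto (fun z => 1 - (h b₁)⁻¹ * h z) (𝓝[≠] b) (𝓝 0) := by
        have := ((hc.tendsto.mono_left (nhdsWithin_le_nhds (s := {b}ᶜ))).const_mul
          (h b₁)⁻¹).const_sub 1
        rwa [hb, inv_mul_cancel₀ hh0, sub_self] at this
      have := (tendsto_zero_iff_meromorphicOrderAt_pos (hgrat.one_sub.1 b)).1 h0
      rw [hD b] at this
      exact_mod_cast this
    have hcont := θ.differentiable.continuous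
    exact ⟨key b₁ rfl (ContinuousAt.div (by fun_prop) (by fun_prop)
        (mul_ne_zero (mul_ne_zero (hne hb₁.2.2.1) (hne hb₁.2.2.2)) n3)),
      key b₂ hh.symm (ContinuousAt.div (by fun_prop) (by fun_prop)
        (mul_ne_zero (mul_ne_zero (hne hb₂.2.2.1) (hne hb₂.2.2.2)) n4))⟩

theorem IsFibreTriple.exists_pair_le {L : PeriodPair} {P : PointGroup L} {n : ℕ} (hP : 0 ≤ P)
    (hn : 2 ≤ n) (h : Finsupp.degree P = n) :
    ∃ x y : Curve L, cls x + cls y ≤ P := by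
  obtain ⟨k, rfl⟩ := Nat.exists_eq_add_of_le' hn
  obtain ⟨x, Q, hQ, hdeg, rfl⟩ := exists_eq_cls_add hP h
  obtain ⟨y, Q', hQ', -, rfl⟩ := exists_eq_cls_add hQ hdeg
  exact ⟨x, y, by rw [← add_assoc]; exact le_add_of_nonneg_right hQ'⟩

theorem pos_of_add_le {L : PeriodPair} {P : PointGroup L} {x y : Curve L}
    (h : cls x + cls y ≤ P) : 0 < P x ∧ 0 < P y := by
  have h1 := h x
  have h2 := h y
  have h3 := cls_nonneg y x
  have h4 := cls_nonneg x y
  simp only [Finsupp.add_apply, cls_apply_self, Finsupp.zero_apply] at *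
  omega

theorem add_le_of_pos {L : PeriodPair} {P : PointGroup L} (hP : 0 ≤ P) {x y : Curve L}
    (hxy : x ≠ y) (hx : 0 < P x) (hy : 0 < P y) : cls x + cls y ≤ P := fun z => by
  have := hP z
  rw [Finsupp.zero_apply] at this
  rw [Finsupp.add_apply]
  by_cases h1 : x = z
  · subst h1
    rw [cls_apply_self, cls_apply_of_ne hxy.symm]; omega
  · rw [cls_apply_of_ne h1]
    by_cases h2 : y = z
    · subst h2; rw [cls_apply_self]; omega
    · rw [cls_apply_of_ne h2]; omega

/-- Two zeros and two poles of `f` may coincide, but the interpolation needs distinct `1`-points. -/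
theorem IsFibreTriple.mem_of_ne {f : ℂ → ℂ} {P Q R : PointGroup (periods τ hτ)} {n : ℕ}
    (hn : 4 ≤ n) (hT : IsFibreTriple f P Q R n)
    (ih : ∀ k < n, RelationsVanish (periods τ hτ) k) {b₁ b₂ : Curve (periods τ hτ)}
    (hb : b₁ ≠ b₂) (hbQ : cls b₁ + cls b₂ ≤ Q) : cyclicPairing P Q R ∈ relationsOrigin _ := by
  obtain ⟨a₁, a₂, ha⟩ := IsFibreTriple.exists_pair_le hT.nonneg₀ (by omega) hT.degree₀
  obtain ⟨c₁, c₂, hc⟩ := IsFibreTriple.exists_pair_le hT.nonneg_top (by omega) hT.degree_top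
  have pa := pos_of_add_le ha
  have pb := pos_of_add_le hbQ
  have pc := pos_of_add_le hc
  have hba {x y : Curve (periods τ hτ)} (hx : 0 < Q x) (hy : 0 < P y) : x ≠ y := by
    rintro rfl
    have := hT.disjoint₀₁ x
    omega
  have hbc {x y : Curve (periods τ hτ)} (hx : 0 < Q x) (hy : 0 < R y) : x ≠ y := by
    rintro rfl
    have := hT.disjoint₁_top x
    omega
  have hac : a₁ ≠ c₁ ∧ a₁ ≠ c₂ := by
    constructor
    all_goals
      rintro rfl
      have := hT.disjoint_top₀ a₁
      omega
  -- With equal sums, Abel's theorem already gives a function of degree two, rescaled to equal `1`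
  -- at `b₁`. The numbers of common zeros, `1`-points and poles are `2, 1, 2`, and any two of them
  -- exceed `m = 2` in sum.
  by_cases ht : c₁ + c₂ = a₁ + a₂
  · obtain ⟨h, hh, hdiv⟩ := exists_hasDivisor_of_pointSum_eq_zero
      (D := cls a₁ + cls a₂ - (cls c₁ + cls c₂)) (by simp) (by simp [ht])
    obtain ⟨k, -, hg, hgC, hgD⟩ := hdiv.exists_normalized hh (x := b₁) (by
      simp [cls_apply_of_ne (hba pb.1 pa.1).symm, cls_apply_of_ne (hba pb.1 pa.2).symm,
        cls_apply_of_ne (hbc pb.1 pc.1).symm, cls_apply_of_ne (hbc pb.1 pc.2).symm])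
    obtain ⟨D, hD⟩ := HasDivisor.exists_sub (.const _ 1) hg (.const one_ne_zero) hgC (fun h => by
      have := DFunLike.congr_fun h a₁
      have h3 := cls_nonneg a₂ a₁
      simp [cls_apply_of_ne hac.1.symm, cls_apply_of_ne hac.2.symm] at this h3
      omega)
    have hZ : 0 ≤ cls a₁ + cls a₂ := add_nonneg (cls_nonneg _) (cls_nonneg _)
    have hW : 0 ≤ cls c₁ + cls c₂ := add_nonneg (cls_nonneg _) (cls_nonneg _)
    have hDW := HasDivisor.one_sub_add_nonneg hg hZ hW hgC hD
    refine hT.mem_of_common_points ih hg hZ hW hgC hD (m := 2) (by simp) (by omega) ha le_rfl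
      (K₁ := cls b₁) ((cls_le_iff hT.nonneg₁).2 pb.1) ((cls_le_iff hDW).2 ?_) hc le_rfl
      (by simp) (by simp) (by simp)
    have h1 := hgD D hD
    have h2 := hW b₁
    simp only [Finsupp.zero_apply, Finsupp.add_apply] at h2 ⊢
    omega
  · obtain ⟨g, a, c, hg, hgC, hgD⟩ := exists_interpolating hb ht
      ⟨hba pb.1 pa.1, hba pb.1 pa.2, hbc pb.1 pc.1, hbc pb.1 pc.2⟩
      ⟨hba pb.2 pa.1, hba pb.2 pa.2, hbc pb.2 pc.1, hbc pb.2 pc.2⟩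
    obtain ⟨D, hD⟩ := HasDivisor.exists_sub (.const _ 1) hg (.const one_ne_zero) hgC (fun h => by
      have heq : cls a₁ + cls a₂ + cls a = cls c₁ + cls c₂ + cls c := (sub_eq_zero.1 h.symm)
      have hca {x : Curve (periods τ hτ)} (hx : 0 < P x) : c₁ ≠ x ∧ c₂ ≠ x := by
        constructor
        all_goals
          rintro rfl
          have h1 := hT.disjoint_top₀ c₁
          have h2 := hT.disjoint_top₀ c₂
          omega
      have h1 := DFunLike.congr_fun heq a₁
      have h2 := DFunLike.congr_fun heq a₂
      have h3 := cls_nonneg a a₁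
      have h4 := cls_nonneg a a₂
      have h5 := cls_nonneg a₂ a₁
      simp only [Finsupp.add_apply, cls_apply_self, cls_apply_of_ne (hca pa.1).1,
        cls_apply_of_ne (hca pa.1).2, cls_apply_of_ne (hca pa.2).1,
        cls_apply_of_ne (hca pa.2).2, Finsupp.zero_apply] at h1 h2 h3 h4 h5
      by_cases hc : c = a₁
      · subst hc
        rw [cls_apply_self] at h1
        omega
      · rw [cls_apply_of_ne hc] at h1
        omega)
    have hZ : 0 ≤ cls a₁ + cls a₂ + cls a :=
      add_nonneg (add_nonneg (cls_nonneg _) (cls_nonneg _)) (cls_nonneg _)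
    have hW : 0 ≤ cls c₁ + cls c₂ + cls c :=
      add_nonneg (add_nonneg (cls_nonneg _) (cls_nonneg _)) (cls_nonneg _)
    have hDW := HasDivisor.one_sub_add_nonneg hg hZ hW hgC hD
    have h1 := hgD D hD
    have h2 := hW b₁
    have h3 := hW b₂
    -- Two common points in each fibre give `2 + 2 > 3`; `m = 3 < n` is where `n ≥ 4` enters.
    refine hT.mem_of_common_points ih hg hZ hW hgC hD (m := 3) (by simp) (by omega) ha
      (le_add_of_nonneg_right (cls_nonneg _)) hbQ (add_le_of_pos hDW hb ?_ ?_) hc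
      (le_add_of_nonneg_right (cls_nonneg _)) (by simp) (by simp) (by simp)
    all_goals
      simp only [Finsupp.zero_apply, Finsupp.add_apply] at h2 h3 ⊢
      omega

/-- Relations of degree at least four follow from relations of smaller degree. -/
theorem relationsVanish_of_four_le {n : ℕ} (hn : 4 ≤ n)
    (ih : ∀ k < n, RelationsVanish (periods τ hτ) k) : RelationsVanish (periods τ hτ) n := by
  intro f P Q R hT
  -- A fibre with two distinct points is moved over `1` by `f ↦ 1 - f` or `f ↦ 1 - 1/f`.
  rcases exists_pair_or_eq_smul hT.nonneg₁ (by omega) hT.degree₁ with ⟨x, y, hxy, h⟩ | ⟨b, hQ⟩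
  · exact hT.mem_of_ne hn ih hxy h
  rcases exists_pair_or_eq_smul hT.nonneg₀ (by omega) hT.degree₀ with ⟨x, y, hxy, h⟩ | ⟨a, hP⟩
  · exact IsFibreTriple.cyclicPairing_swap_mem_iff.1 (hT.one_sub.mem_of_ne hn ih hxy h)
  rcases exists_pair_or_eq_smul hT.nonneg_top (by omega) hT.degree_top with ⟨x, y, hxy, h⟩ | ⟨c, hR⟩
  · exact IsFibreTriple.cyclicPairing_mem_iff.1 (hT.rotate.mem_of_ne hn ih hxy h)
  subst hP hQ hR
  exact (hT.not_totally_ramified hn).elim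

end

/-! ### Degrees zero, one and two -/

section

section

variable {L : PeriodPair}

/-- The lattice is countable and `ℂ` is not. This supplies the points in general position used
below. -/
instance infinite_curve (L : PeriodPair) : Infinite (Curve L) := by
  by_contra h
  rw [not_infinite_iff_finite] at h
  have : Countable L.lattice := L.latticeEquivProd.toEquiv.countable_iff.2 inferInstance
  have hinj : Function.Injective fun z : ℂ =>
      ((pt L z, ⟨z - rep (pt L z), pt_eq_pt_iff.1 (pt_rep _).symm⟩) : Curve L × L.lattice) := by
    intro z w hzw
    simp only [Prod.mk.injEq, Subtype.mk.injEq] at hzw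
    rw [hzw.1] at hzw
    exact sub_left_injective hzw.2
  have hc : Countable ℂ := hinj.countable
  exact not_countable (α := ℝ) (Function.Injective.countable Complex.ofReal_injective)

theorem exists_notMem_finset (s : Finset (Curve L)) : ∃ x, x ∉ s := Infinite.exists_notMem_finset s

theorem disjoint_of_apply_eq_zero {P : PointGroup L} {a b c : Curve L} (ha : P a = 0)
    (hb : P b = 0) (hc : P c = 0) (x : Curve L) : (cls a + cls b + cls c) x = 0 ∨ P x = 0 := by
  by_cases hxa : a = x
  · exact Or.inr (hxa ▸ ha)
  by_cases hxb : b = x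
  · exact Or.inr (hxb ▸ hb)
  by_cases hxc : c = x
  · exact Or.inr (hxc ▸ hc)
  left
  simp [cls_apply_of_ne hxa, cls_apply_of_ne hxb, cls_apply_of_ne hxc]

theorem sum_cls_apply_eq_zero {a b c x : Curve L} (ha : a ≠ x) (hb : b ≠ x) (hc : c ≠ x) :
    (cls a + cls b + cls c) x = 0 := by
  simp [cls_apply_of_ne ha, cls_apply_of_ne hb, cls_apply_of_ne hc]

theorem HasDivisor.min_le_sub {f g : ℂ → ℂ} {A B D : PointGroup L}
    (hf : IsRationalFunction L f) (hg : IsRationalFunction L g) (hA : HasDivisor f A)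
    (hB : HasDivisor g B) (hD : HasDivisor (fun z => f z - g z) D) (x : Curve L) :
    min (A x) (B x) ≤ D x := by
  obtain ⟨z, rfl⟩ := pt_surjective x
  have h := meromorphicOrderAt_add (f₁ := f) (f₂ := fun z => -g z) (hf.1 z) (hg.1 z).neg
  have heq : (f + fun z => -g z) = fun z => f z - g z := by
    ext z; simp [sub_eq_add_neg]
  rw [heq, hA z, hB.neg z, hD z] at h
  exact_mod_cast h

end

variable {τ : ℂ} {hτ : τ.im ≠ 0}

theorem relationsVanish_zero : RelationsVanish (periods τ hτ) 0 := by
  intro f P Q R hT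
  rw [eq_zero_of_degree_eq_zero hT.nonneg₀ hT.degree₀,
    eq_zero_of_degree_eq_zero hT.nonneg₁ hT.degree₁]
  simp [cyclicPairing]

/-- By Abel's theorem the only zero and the only pole would coincide, so no such function exists. -/
theorem relationsVanish_one : RelationsVanish (periods τ hτ) 1 := by
  intro f P Q R hT
  obtain ⟨p, rfl⟩ := exists_eq_sum_cls hT.nonneg₀ hT.degree₀
  obtain ⟨r, rfl⟩ := exists_eq_sum_cls hT.nonneg_top hT.degree_top
  have h := (hT.divisor₀.degree_and_pointSum hT.rational).2
  have h' := hT.disjoint_top₀ (p 0)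
  simp [sub_eq_zero] at h h'
  rw [← h] at h'
  simp at h'

/-- A family of auxiliary functions: for a function of degree two with fibres `a₁ + a₂`,
`b₁ + b₂`, `c₁ + c₂` there is a function `u` with zeros `c₂, x, y` and poles `a₂, p, q` in general
position, with `u = 1` at `b₁` but not on all of `b₁ + b₂`. -/
theorem exists_auxiliary_function {a₁ a₂ b₁ b₂ c₁ c₂ : Curve (periods τ hτ)} (hbc₁ : b₁ ≠ c₂)
    (hbc₂ : b₂ ≠ c₂) (hba : b₁ ≠ a₂) (hac : a₂ ≠ c₂) :
    ∃ (u : ℂ → ℂ) (V : PointGroup (periods τ hτ)) (x y p q : Curve (periods τ hτ)),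
      IsRationalFunction (periods τ hτ) u ∧
      HasDivisor u (cls c₂ + cls x + cls y - (cls a₂ + cls p + cls q)) ∧
      HasDivisor (fun z => 1 - u z) V ∧ 0 < V b₁ ∧
      ¬ cls b₁ + cls b₂ ≤ V + (cls a₂ + cls p + cls q) ∧
      (∀ w, w = p ∨ w = q →
        w ≠ a₁ ∧ w ≠ c₂ ∧ w ≠ b₁ ∧ w ≠ b₂ ∧ w ≠ x ∧ w ≠ y) ∧
      (∀ w, w = x ∨ w = y → w ≠ c₁ ∧ w ≠ a₂) := by
  classical
  obtain ⟨p, hp⟩ := exists_notMem_finset ({a₁, c₂, b₁, b₂} : Finset (Curve (periods τ hτ)))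
  -- The last exclusion prevents `c₂ + b₁ + b₂ - (a₂ + p + q)` from being a principal divisor.
  obtain ⟨q, hq⟩ := exists_notMem_finset
    ({a₁, c₂, b₁, b₂, c₂ + b₁ + b₂ - a₂ - p} : Finset (Curve (periods τ hτ)))
  simp only [Finset.mem_insert, Finset.mem_singleton, not_or] at hp hq
  obtain ⟨hpa, hpc, hpb₁, hpb₂⟩ := hp
  obtain ⟨hqa, hqc, hqb₁, hqb₂, hsum⟩ := hq
  have hsum' : a₂ + p + q ≠ c₂ + b₁ + b₂ := fun h => hsum (by rw [← h]; abel)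
  -- Abel's theorem makes `s - x` the third zero once `c₂` and `x` are zeros.
  set s := a₂ + p + q - c₂ with hs
  set W : PointGroup (periods τ hτ) := cls a₂ + cls p + cls q with hW
  have hW0 : 0 ≤ W := add_nonneg (add_nonneg (cls_nonneg _) (cls_nonneg _)) (cls_nonneg _)
  let F : Finset (Curve (periods τ hτ)) := {c₁, p, q, a₂, b₁}
  have hfun (x : Curve (periods τ hτ)) (hx : x ∉ F) (hx' : s - x ∉ F) :
      ∃ (u : ℂ → ℂ) (V : PointGroup (periods τ hτ)), IsRationalFunction (periods τ hτ) u ∧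
        HasDivisor u (cls c₂ + cls x + cls (s - x) - W) ∧ HasDivisor (fun z => 1 - u z) V ∧
        0 < V b₁ := by
    simp only [F, Finset.mem_insert, Finset.mem_singleton, not_or] at hx hx'
    obtain ⟨h, hh, hdiv⟩ := exists_hasDivisor_of_pointSum_eq_zero
      (D := cls c₂ + cls x + cls (s - x) - W) (by simp [hW]) (by simp [hW, hs])
    obtain ⟨k, -, hg, hgC, hgD⟩ := hdiv.exists_normalized hh (x := b₁) (by
      rw [Finsupp.sub_apply, sum_cls_apply_eq_zero hbc₁.symm hx.2.2.2.2 hx'.2.2.2.2,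
        sum_cls_apply_eq_zero hba.symm hpb₁ hqb₁, sub_zero])
    obtain ⟨V, hV⟩ := HasDivisor.exists_sub (.const _ 1) hg (.const one_ne_zero) hgC (fun h => by
      have h1 := DFunLike.congr_fun h c₂
      have h2 := cls_nonneg x c₂
      have h3 := cls_nonneg (s - x) c₂
      rw [Finsupp.sub_apply, sum_cls_apply_eq_zero hac hpc hqc] at h1
      simp only [Finsupp.add_apply, cls_apply_self, Finsupp.zero_apply] at h1 h2 h3
      omega)
    exact ⟨_, V, hg, hgC, hV, hgD V hV⟩
  have hsub (G : Finset (Curve (periods τ hτ))) : ∃ x, x ∉ G ∧ s - x ∉ G := by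
    obtain ⟨x, hx⟩ := exists_notMem_finset (G ∪ G.image (s - ·))
    simp only [Finset.mem_union, Finset.mem_image, not_or, not_exists, not_and] at hx
    exact ⟨x, hx.1, fun h => hx.2 _ h (sub_sub_cancel s x)⟩
  have hgood : ∃ x, ∃ (u : ℂ → ℂ) (V : PointGroup (periods τ hτ)), (x ∉ F ∧ s - x ∉ F) ∧
      IsRationalFunction (periods τ hτ) u ∧
      HasDivisor u (cls c₂ + cls x + cls (s - x) - W) ∧ HasDivisor (fun z => 1 - u z) V ∧
      0 < V b₁ ∧ ¬ cls b₁ + cls b₂ ≤ V + W := by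
    obtain ⟨x, hx, hx'⟩ := hsub F
    obtain ⟨x', hx₁, hx₁'⟩ := hsub (insert x F)
    obtain ⟨u, V, hu, hU, hV, hVb⟩ := hfun x hx hx'
    obtain ⟨u', V', hu', hU', hV', hVb'⟩ := hfun x' (fun h => hx₁ (Finset.mem_insert_of_mem h))
      (fun h => hx₁' (Finset.mem_insert_of_mem h))
    by_cases hbad : cls b₁ + cls b₂ ≤ V + W
    swap
    · exact ⟨x, u, V, ⟨hx, hx'⟩, hu, hU, hV, hVb, hbad⟩
    by_cases hbad' : cls b₁ + cls b₂ ≤ V' + W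
    swap
    · exact ⟨x', u', V', ⟨fun h => hx₁ (Finset.mem_insert_of_mem h),
        fun h => hx₁' (Finset.mem_insert_of_mem h)⟩, hu', hU', hV', hVb', hbad'⟩
    -- If two candidates with different zeros both equal `1` on `b₁ + b₂`, their difference vanishes
    -- on `c₂ + b₁ + b₂` and has poles at most `W`. By degrees this is its exact divisor, which
    -- Abel's theorem excludes through `hsum'`.
    exfalso
    have hne : cls c₂ + cls x + cls (s - x) - W ≠ cls c₂ + cls x' + cls (s - x') - W := by
      intro h
      have h1 := DFunLike.congr_fun h x
      have hx1 : x' ≠ x := fun h => hx₁ (Finset.mem_insert.2 (Or.inl h))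
      have hx2 : s - x' ≠ x := fun h => hx₁' (Finset.mem_insert.2 (Or.inl h))
      have h2 := cls_nonneg (s - x) x
      simp only [Finsupp.add_apply, Finsupp.sub_apply, cls_apply_self, cls_apply_of_ne hx1,
        cls_apply_of_ne hx2, Finsupp.zero_apply] at h1 h2
      omega
    obtain ⟨Y, hY⟩ := HasDivisor.exists_sub hu hu' hU hU' hne
    have hY' : HasDivisor (fun z => (1 - u z) - (1 - u' z)) Y := by
      convert hY.neg using 2
      ring
    have hle : cls c₂ + cls b₁ + cls b₂ ≤ Y + W := fun w => by
      have h1 := HasDivisor.min_le_sub hu hu' hU hU' hY w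
      have h2 := HasDivisor.min_le_sub hu.one_sub hu'.one_sub hV hV' hY' w
      have h3 := hbad w
      have h4 := hbad' w
      have h5 := cls_nonneg x w
      have h6 := cls_nonneg (s - x) w
      have h7 := cls_nonneg x' w
      have h8 := cls_nonneg (s - x') w
      simp only [Finsupp.add_apply, Finsupp.sub_apply, Finsupp.zero_apply] at *
      by_cases hw : c₂ = w
      · subst hw
        rw [cls_apply_self, cls_apply_of_ne hbc₁, cls_apply_of_ne hbc₂] at *
        omega
      · rw [cls_apply_of_ne hw] at *
        omega
    have hdY := hY.degree_and_pointSum (hu.sub hu')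
    have h0 := eq_zero_of_degree_eq_zero (sub_nonneg.2 hle) (by
      simp [hdY.1, hW])
    have := congrArg pointSum h0
    simp only [map_sub, map_add, hdY.2, hW, pointSum_cls, zero_add, map_zero, sub_eq_zero] at this
    exact hsum' this
  obtain ⟨x, u, V, ⟨hx, hx'⟩, hu, hU, hV, hVb, hbad⟩ := hgood
  simp only [F, Finset.mem_insert, Finset.mem_singleton, not_or] at hx hx'
  refine ⟨u, V, x, s - x, p, q, hu, hU, hV, hVb, hbad, ?_, ?_⟩
  · simp only [forall_eq_or_imp, forall_eq]
    exact ⟨⟨hpa, hpc, hpb₁, hpb₂, Ne.symm hx.2.1, Ne.symm hx'.2.1⟩,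
      hqa, hqc, hqb₁, hqb₂, Ne.symm hx.2.2.1, Ne.symm hx'.2.2.1⟩
  · simp only [forall_eq_or_imp, forall_eq]
    exact ⟨⟨hx.1, hx.2.2.2.1⟩, hx'.1, hx'.2.2.2.1⟩

theorem ne_of_disjoint_pairs {L : PeriodPair} {x₁ x₂ y₁ y₂ : Curve L}
    (h : ∀ w, (cls x₁ + cls x₂) w = 0 ∨ (cls y₁ + cls y₂) w = 0) :
    x₁ ≠ y₁ ∧ x₁ ≠ y₂ ∧ x₂ ≠ y₁ ∧ x₂ ≠ y₂ := by
  have hx := pos_of_add_le (le_refl (cls x₁ + cls x₂))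
  have hy := pos_of_add_le (le_refl (cls y₁ + cls y₂))
  have h1 := h x₁
  have h2 := h x₂
  refine ⟨?_, ?_, ?_, ?_⟩
  all_goals
    rintro rfl
    omega

theorem pair_apply_eq_zero {L : PeriodPair} {a b x : Curve L} (ha : a ≠ x) (hb : b ≠ x) :
    (cls a + cls b) x = 0 := by
  simp [cls_apply_of_ne ha, cls_apply_of_ne hb]

/-- The five-term relation with `g = f u`: multiplication by `u` replaces the zero `a₂` by `x, y`
and the pole `c₂` by `p, q`, and `b₁` is a common `1`-point. General position rules out further
cancellation. Degree exactly three is essential, because a function of degree two would make the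
argument circular. -/
theorem IsFibreTriple.mem_of_degree_two (h₃ : RelationsVanish (periods τ hτ) 3) {f : ℂ → ℂ}
    {a₁ a₂ b₁ b₂ c₁ c₂ : Curve (periods τ hτ)}
    (hT : IsFibreTriple f (cls a₁ + cls a₂) (cls b₁ + cls b₂) (cls c₁ + cls c₂) 2) :
    cyclicPairing (cls a₁ + cls a₂) (cls b₁ + cls b₂) (cls c₁ + cls c₂) ∈
      relationsOrigin (periods τ hτ) := by
  obtain ⟨a1b1, a1b2, a2b1, a2b2⟩ := ne_of_disjoint_pairs hT.disjoint₀₁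
  obtain ⟨b1c1, b1c2, b2c1, b2c2⟩ := ne_of_disjoint_pairs hT.disjoint₁_top
  obtain ⟨c1a1, c1a2, c2a1, c2a2⟩ := ne_of_disjoint_pairs hT.disjoint_top₀
  obtain ⟨u, V, x, y, p, q, hu, hU, hV, hVb, hbad, hpq, hxy⟩ :=
    exists_auxiliary_function (a₁ := a₁) (c₁ := c₁) b1c2 b2c2 a2b1.symm c2a2.symm
  obtain ⟨⟨pa, pc, pb₁, pb₂, px, py⟩, qa, qc, qb₁, qb₂, qx, qy⟩ :=
    And.intro (hpq p (Or.inl rfl)) (hpq q (Or.inr rfl))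
  obtain ⟨⟨xc, xa⟩, yc, ya⟩ := And.intro (hxy x (Or.inl rfl)) (hxy y (Or.inr rfl))
  set W : PointGroup (periods τ hτ) := cls a₂ + cls p + cls q with hW
  have three_nonneg (x y z : Curve (periods τ hτ)) : 0 ≤ cls x + cls y + cls z :=
    add_nonneg (add_nonneg (cls_nonneg _) (cls_nonneg _)) (cls_nonneg _)
  have hf := hT.rational
  have hg := hf.mul hu
  have hgC : HasDivisor (fun z => f z * u z)
      (cls a₁ + cls x + cls y - (cls c₁ + cls p + cls q)) := by
    convert hT.divisor₀.mul hf hu hU using 1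
    rw [hW]
    abel
  set X : PointGroup (periods τ hτ) := cls a₁ + cls x + cls y with hX
  set Y : PointGroup (periods τ hτ) := cls c₁ + cls p + cls q with hY
  have hXY : ∀ w, Y w = 0 ∨ X w = 0 :=
    disjoint_of_apply_eq_zero (sum_cls_apply_eq_zero c1a1.symm xc yc)
      (sum_cls_apply_eq_zero (Ne.symm pa) (Ne.symm px) (Ne.symm py))
      (sum_cls_apply_eq_zero (Ne.symm qa) (Ne.symm qx) (Ne.symm qy))
  have hXa : 0 < X a₁ := (cls_le_iff (three_nonneg _ _ _)).1 (by
    rw [add_assoc]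
    exact le_add_of_nonneg_right (add_nonneg (cls_nonneg _) (cls_nonneg _)))
  obtain ⟨D, hD⟩ := HasDivisor.exists_sub (.const _ 1) hg (.const one_ne_zero) hgC (fun h => by
    have h1 := DFunLike.congr_fun h a₁
    have h2 := hXY a₁
    simp only [Finsupp.sub_apply, Finsupp.zero_apply] at h1
    omega)
  have hE : HasDivisor (fun z => f z - f z * u z) (cls a₁ + cls a₂ - (cls c₁ + cls c₂) + V) := by
    convert hT.divisor₀.mul hf hu.one_sub hV using 2
    ring
  have hDY := HasDivisor.one_sub_add_nonneg hg (three_nonneg _ _ _) (three_nonneg _ _ _) hgC hD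
  have hDapply := HasDivisor.one_sub_apply hg hgC hD
  -- Since `1 - g = (f - g) + (1 - f)` and both terms vanish at `b₁`, so does `1 - g`.
  have hBE : HasDivisor (fun z => (f z - f z * u z) - -(1 - f z)) D := by
    convert hD using 2
    ring
  have hminD := HasDivisor.min_le_sub (hf.sub hg) (g := fun z => -(1 - f z))
    (by simpa using (IsRationalFunction.const _ 0).sub hf.one_sub) hE hT.divisor₁.neg hBE
  have hEB : HasDivisor (fun z => (1 - f z * u z) - (1 - f z))
      (cls a₁ + cls a₂ - (cls c₁ + cls c₂) + V) := by
    convert hE using 2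
    ring
  have hminV := HasDivisor.min_le_sub hg.one_sub hf.one_sub hD hT.divisor₁ hEB
  have hYb₁ : Y b₁ = 0 := sum_cls_apply_eq_zero b1c1.symm pb₁ qb₁
  have hYb₂ : Y b₂ = 0 := sum_cls_apply_eq_zero b2c1.symm pb₂ qb₂
  have hAb₁ : (cls a₁ + cls a₂ - (cls c₁ + cls c₂)) b₁ = 0 := by
    rw [Finsupp.sub_apply, pair_apply_eq_zero a1b1 a2b1, pair_apply_eq_zero b1c1.symm b1c2.symm,
      sub_zero]
  have hAb₂ : (cls a₁ + cls a₂ - (cls c₁ + cls c₂)) b₂ = 0 := by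
    rw [Finsupp.sub_apply, pair_apply_eq_zero a1b2 a2b2, pair_apply_eq_zero b2c1.symm b2c2.symm,
      sub_zero]
  have hCb₁ := pair_apply_eq_zero b1c1.symm b1c2.symm
  have hCb₂ := pair_apply_eq_zero b2c1.symm b2c2.symm
  have hBpos := pos_of_add_le (le_refl (cls b₁ + cls b₂))
  have hDb₁ : 0 < (D + Y) b₁ := by
    have h1 := hminD b₁
    simp only [Finsupp.add_apply, Finsupp.sub_apply] at h1 hAb₁ hCb₁ hBpos ⊢
    omega
  have hV0 : 0 ≤ V + W := HasDivisor.one_sub_add_nonneg hu (three_nonneg _ _ _)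
    (three_nonneg _ _ _) hU hV
  -- `B'` consists of the two `1`-points of `g` other than the chosen `b₁`.
  obtain ⟨B', hB'⟩ : ∃ B', B' = D + Y - cls b₁ := ⟨_, rfl⟩
  have hB'0 : 0 ≤ B' := by
    rw [hB']
    exact sub_nonneg.2 ((cls_le_iff hDY).2 hDb₁)
  -- If `1 - g` vanished on `b₁ + b₂`, so would `(1 - g) - (1 - f) = f (1 - u)`. As `f` has order
  -- zero at these points, `1 - u` would vanish there, against the choice of `u`.
  have hnle : ¬ cls b₁ + cls b₂ ≤ D + Y := fun hle => hbad fun w => by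
    by_cases hw : w = b₁ ∨ w = b₂
    · have h1 := hle w
      have h2 := hminV w
      have h3 : 0 ≤ W w := three_nonneg a₂ p q w
      rcases hw with rfl | rfl
      all_goals
        simp only [Finsupp.add_apply, Finsupp.sub_apply] at *
        omega
    · push Not at hw
      rw [pair_apply_eq_zero hw.1.symm hw.2.symm]
      exact hV0 w
  have hB'b₂ : B' b₂ = 0 := by
    by_contra hne
    have h1 := (cls_le_iff hB'0).2 (lt_of_le_of_ne (hB'0 b₂) (Ne.symm hne))
    refine hnle ?_
    rw [hB', le_sub_iff_add_le, add_comm] at h1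
    exact h1
  have hB'le (w : Curve (periods τ hτ)) (h : (D + Y) w = 0) : B' w = 0 := by
    have h1 := hB'0 w
    have h2 := cls_nonneg b₁ w
    rw [hB'] at h1 ⊢
    rw [Finsupp.sub_apply, Finsupp.zero_apply, h] at *
    omega
  have hB'Y (w : Curve (periods τ hτ)) (hw : 0 < Y w) : B' w = 0 := by
    refine hB'le w ?_
    have h1 := hXY w
    have h2 := (hDapply w).1
    simp only [Finsupp.sub_apply, Finsupp.add_apply] at h2 ⊢
    omega
  have hB'X (w : Curve (periods τ hτ)) (hw : 0 < X w) : B' w = 0 := by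
    refine hB'le w ?_
    have h1 := hXY w
    have h2 := (hDapply w).2.1
    simp only [Finsupp.sub_apply, Finsupp.add_apply] at h2 ⊢
    omega
  have hpos₂ (x y z : Curve (periods τ hτ)) : 0 < (cls x + cls y + cls z) y :=
    (cls_le_iff (three_nonneg _ _ _)).1 (by
      rw [add_right_comm]
      exact le_add_of_nonneg_left (add_nonneg (cls_nonneg _) (cls_nonneg _)))
  have hpos₃ (x y z : Curve (periods τ hτ)) : 0 < (cls x + cls y + cls z) z :=
    (cls_le_iff (three_nonneg _ _ _)).1
      (le_add_of_nonneg_left (add_nonneg (cls_nonneg _) (cls_nonneg _)))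
  have hdegD := (hD.degree_and_pointSum hg.one_sub).1
  have hdegB' : Finsupp.degree B' = 2 := by
    rw [hB', map_sub, map_add, hdegD, hY]
    simp
  rw [← pairing_sub_sub_mem_iff]
  -- The divisors to treat are `X - Y`, `W - (c₂ + x + y)`, `b₂ + p + q - (c₂ + B')` and `a₂ + B' -
  -- (b₂ + x + y)`, each a difference of disjoint effective divisors of degree three.
  refine pairing_mem_of_five_term hf hg hT.divisor₀ hT.divisor₁ hgC hD hE
    (.of_disjoint (three_nonneg _ _ _) (three_nonneg _ _ _) hXY (by simp [hX]) h₃) ?_ ?_ ?_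
  · rw [show cls a₁ + cls a₂ - (cls c₁ + cls c₂) - (X - Y) = W - (cls c₂ + cls x + cls y) by
      rw [hX, hY, hW]; abel]
    exact .of_disjoint (three_nonneg _ _ _) (three_nonneg _ _ _)
      (disjoint_of_apply_eq_zero (sum_cls_apply_eq_zero c2a2.symm pc qc)
        (sum_cls_apply_eq_zero (Ne.symm xa) px qx) (sum_cls_apply_eq_zero (Ne.symm ya) py qy))
      (by simp [hW]) h₃
  · rw [show cls b₁ + cls b₂ - (cls c₁ + cls c₂) - D = cls b₂ + cls p + cls q - (cls c₂ + B') by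
      rw [hB', hY]; abel]
    refine .of_disjoint (three_nonneg _ _ _) (add_nonneg (cls_nonneg _) hB'0)
      (fun w => (disjoint_of_apply_eq_zero ?_ ?_ ?_ w).symm) (by simp) h₃
    · rw [Finsupp.add_apply, cls_apply_of_ne b2c2.symm, hB'b₂, add_zero]
    · rw [Finsupp.add_apply, cls_apply_of_ne (Ne.symm pc), hB'Y _ (hpos₂ _ _ _), add_zero]
    · rw [Finsupp.add_apply, cls_apply_of_ne (Ne.symm qc), hB'Y _ (hpos₃ _ _ _), add_zero]
  · rw [show cls a₁ + cls a₂ - (cls c₁ + cls c₂) + D - (X - Y) -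
        (cls b₁ + cls b₂ - (cls c₁ + cls c₂)) = cls a₂ + B' - (cls b₂ + cls x + cls y) by
      rw [hB', hX]; abel]
    refine .of_disjoint (add_nonneg (cls_nonneg _) hB'0) (three_nonneg _ _ _)
      (disjoint_of_apply_eq_zero ?_ ?_ ?_) (by simp [hdegB']) h₃
    · rw [Finsupp.add_apply, cls_apply_of_ne a2b2, hB'b₂, add_zero]
    · rw [Finsupp.add_apply, cls_apply_of_ne (Ne.symm xa), hB'X _ (hpos₂ _ _ _), add_zero]
    · rw [Finsupp.add_apply, cls_apply_of_ne (Ne.symm ya), hB'X _ (hpos₃ _ _ _), add_zero]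

/-- Relations of degree two follow from relations of degree three. -/
theorem relationsVanish_two (h₃ : RelationsVanish (periods τ hτ) 3) :
    RelationsVanish (periods τ hτ) 2 := by
  intro f P Q R hT
  obtain ⟨a, rfl⟩ := exists_eq_sum_cls hT.nonneg₀ hT.degree₀
  obtain ⟨b, rfl⟩ := exists_eq_sum_cls hT.nonneg₁ hT.degree₁
  obtain ⟨c, rfl⟩ := exists_eq_sum_cls hT.nonneg_top hT.degree_top
  simp only [Fin.sum_univ_two] at hT ⊢
  exact hT.mem_of_degree_two h₃

/-- The relation of every function follows from the relations of functions of degree three. -/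
theorem relationsVanish_of_degree_three (h₃ : RelationsVanish (periods τ hτ) 3) (n : ℕ) :
    RelationsVanish (periods τ hτ) n := by
  induction n using Nat.strong_induction_on with
  | _ n ih =>
    match n with
    | 0 => exact relationsVanish_zero
    | 1 => exact relationsVanish_one
    | 2 => exact relationsVanish_two h₃
    | 3 => exact h₃
    | n + 4 => exact relationsVanish_of_four_le (by omega) ih

end

section

/-! ### Elliptic functions with a triple pole at the origin -/

theorem le_meromorphicOrderAt_sub {f g : ℂ → ℂ} {z : ℂ} {k : WithTop ℤ} (hf : MeromorphicAt f z)
    (hg : MeromorphicAt g z) (h : k ≤ meromorphicOrderAt f z) (h' : k ≤ meromorphicOrderAt g z) :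
    k ≤ meromorphicOrderAt (fun z => f z - g z) z := by
  have := meromorphicOrderAt_add (f₁ := f) (f₂ := fun z => -g z) hf hg.neg
  rw [← meromorphicOrderAt_fun_neg] at this
  have heq : (f + fun z => -g z) = fun z => f z - g z := by
    ext z; simp [sub_eq_add_neg]
  rw [heq] at this
  exact (le_min h h').trans this

theorem le_meromorphicOrderAt_const_mul {g : ℂ → ℂ} {z : ℂ} {k : WithTop ℤ} (c : ℂ)
    (hg : MeromorphicAt g z) (h : k ≤ meromorphicOrderAt g z) :
    k ≤ meromorphicOrderAt (fun z => c * g z) z := by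
  rw [fun_meromorphicOrderAt_mul (.const c z) hg]
  exact h.trans (le_add_of_nonneg_left analyticAt_const.meromorphicOrderAt_nonneg)

/-- A suitable multiple of `g` cancels the leading term of `f`. -/
theorem exists_lt_meromorphicOrderAt_sub {f g : ℂ → ℂ} {z : ℂ} {k : ℤ} (hf : MeromorphicAt f z)
    (hg : MeromorphicAt g z) (h : (k : WithTop ℤ) ≤ meromorphicOrderAt f z)
    (h' : meromorphicOrderAt g z = k) :
    ∃ c : ℂ, ((k + 1 : ℤ) : WithTop ℤ) ≤ meromorphicOrderAt (fun z => f z - c * g z) z := by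
  have hg0 : ∀ᶠ w in 𝓝[≠] z, g w ≠ 0 :=
    (meromorphicOrderAt_ne_top_iff_eventually_ne_zero hg).1 (by rw [h']; exact WithTop.coe_ne_top)
  have hq : 0 ≤ meromorphicOrderAt (fun z => f z / g z) z := by
    rw [fun_meromorphicOrderAt_div hf hg, h']
    cases hfz : meromorphicOrderAt f z with
    | top => exact le_top
    | coe m =>
      rw [hfz] at h
      have h1 : k ≤ m := by exact_mod_cast h
      have h2 : 0 ≤ m - k := by omega
      exact_mod_cast h2
  have hqm : MeromorphicAt (fun z => f z / g z) z := hf.div hg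
  obtain ⟨c, hc⟩ := tendsto_nhds_of_meromorphicOrderAt_nonneg hqm hq
  have h0 : Tendsto (fun z => f z / g z - c) (𝓝[≠] z) (𝓝 0) := by
    have := hc.sub_const c
    rwa [sub_self] at this
  have hqc : MeromorphicAt (fun z => f z / g z - c) z := hqm.sub (.const c z)
  have hpos := (tendsto_zero_iff_meromorphicOrderAt_pos hqc).1 h0
  refine ⟨c, ?_⟩
  have heq : (fun z => f z - c * g z) =ᶠ[𝓝[≠] z] fun z => g z * (f z / g z - c) := by
    filter_upwards [hg0] with w hw
    field_simp
  rw [meromorphicOrderAt_congr heq, fun_meromorphicOrderAt_mul hg hqc, h']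
  cases hm : meromorphicOrderAt (fun z => f z / g z - c) z with
  | top => exact le_top
  | coe m =>
    rw [hm] at hpos
    have h1 : 0 < m := by exact_mod_cast hpos
    have h2 : k + 1 ≤ k + m := by omega
    exact_mod_cast h2

section

variable (L : PeriodPair)

theorem isRationalFunction_weierstrassP : IsRationalFunction L L.weierstrassP :=
  ⟨L.meromorphic_weierstrassP, fun l hl => L.periodic_weierstrassP ⟨l, hl⟩⟩

theorem isRationalFunction_derivWeierstrassP : IsRationalFunction L L.derivWeierstrassP :=
  ⟨L.meromorphic_derivWeierstrassP, fun l hl => L.periodic_derivWeierstrassP ⟨l, hl⟩⟩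

variable {L}

theorem order_derivWeierstrassP {l : ℂ} (hl : l ∈ L.lattice) :
    meromorphicOrderAt L.derivWeierstrassP l = ((-3 : ℤ) : WithTop ℤ) := by
  rw [← L.deriv_weierstrassP]
  exact meromorphicOrderAt_deriv_eq_sub_one (n := -2) (by norm_num) (L.order_weierstrassP l hl)

theorem order_weierstrassP_nonneg {z : ℂ} (hz : z ∉ L.lattice) :
    0 ≤ meromorphicOrderAt L.weierstrassP z :=
  (L.analyticOnNhd_weierstrassP z hz).meromorphicOrderAt_nonneg

theorem order_derivWeierstrassP_nonneg {z : ℂ} (hz : z ∉ L.lattice) :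
    0 ≤ meromorphicOrderAt L.derivWeierstrassP z :=
  (L.analyticOnNhd_derivWeierstrassP z hz).meromorphicOrderAt_nonneg

/-- The restriction to the curve of the linear form with coefficients `h`. -/
def lineFunction (L : PeriodPair) (h : Fin 3 → ℂ) (z : ℂ) : ℂ :=
  h ⬝ᵥ ![L.weierstrassP z, L.derivWeierstrassP z, 1]

theorem lineFunction_eq (h : Fin 3 → ℂ) (z : ℂ) : lineFunction L h z =
    h 0 * L.weierstrassP z + h 1 * L.derivWeierstrassP z + h 2 := by
  simp [lineFunction, dotProduct, Fin.sum_univ_three]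

theorem isRationalFunction_lineFunction (h : Fin 3 → ℂ) :
    IsRationalFunction L (lineFunction L h) := by
  rw [funext (lineFunction_eq h)]
  exact (((IsRationalFunction.const L _).mul (isRationalFunction_weierstrassP L)).add
    ((IsRationalFunction.const L _).mul (isRationalFunction_derivWeierstrassP L))).add (.const L _)

/-- The factor `(w - z₀)³` in the lift shifts the order by three at the origin, so a line section is
a divisor of zeros minus `3[0]`. -/
theorem lineMultiplicity_eq (h : Fin 3 → ℂ) (z : ℂ) :
    lineMultiplicity L h z = ((3 * cls (0 : Curve L) (pt L z) : ℤ) : WithTop ℤ) +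
      meromorphicOrderAt (lineFunction L h) z := by
  classical
  have hmer := (isRationalFunction_lineFunction (L := L) h).1 z
  by_cases hz : z ∈ L.lattice
  · have h1 : (fun w => h ⬝ᵥ cubicLift L z w) = fun w => (w - z) ^ 3 * lineFunction L h w := by
      ext w
      rw [cubicLift, if_pos hz, dotProduct_smul, smul_eq_mul, lineFunction]
    rw [lineMultiplicity, h1, fun_meromorphicOrderAt_mul (by fun_prop) hmer,
      fun_meromorphicOrderAt_pow_id_sub_const, pt_eq_zero_iff.2 hz, cls_apply_self]
    rfl
  · have h1 : (fun w => h ⬝ᵥ cubicLift L z w) = lineFunction L h := by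
      ext w
      rw [cubicLift, if_neg hz, one_smul, lineFunction]
    rw [lineMultiplicity, h1, cls_apply_of_ne (fun h => hz (pt_eq_zero_iff.1 h.symm))]
    simp

theorem isLineSection_of_hasDivisor {h : Fin 3 → ℂ} {p : Fin 3 → Curve L}
    (hd : HasDivisor (lineFunction L h) (∑ i, cls (p i) - (3 : ℤ) • cls 0)) :
    IsLineSection h p := fun z => by
  rw [lineMultiplicity_eq, hd z, ← WithTop.coe_add]
  congr 1
  simp

/-- At the origin a form vanishing on `[0 : 1 : 0]` has no `℘'` term, so its pole has order at most
two instead of three. -/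
theorem lineMultiplicity_pos {h : Fin 3 → ℂ} {z : ℂ} (hz : h ⬝ᵥ cubicPoint L z = 0) :
    0 < lineMultiplicity L h z := by
  classical
  rw [lineMultiplicity_eq]
  by_cases hl : z ∈ L.lattice
  · rw [cubicPoint, if_pos hl] at hz
    have h1 : h 1 = 0 := by simpa [dotProduct, Fin.sum_univ_three] using hz
    have heq : lineFunction L h = fun z => h 0 * L.weierstrassP z - -h 2 * 1 := by
      ext w
      rw [lineFunction_eq, h1]
      ring
    have hle : ((-2 : ℤ) : WithTop ℤ) ≤ meromorphicOrderAt (lineFunction L h) z := by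
      rw [heq]
      refine le_meromorphicOrderAt_sub ((MeromorphicAt.const _ _).mul
        (L.meromorphic_weierstrassP z)) (.const _ _) (le_meromorphicOrderAt_const_mul _
        (L.meromorphic_weierstrassP z) (L.order_weierstrassP z hl).ge) ?_
      exact le_trans (by exact_mod_cast (by norm_num : (-2 : ℤ) ≤ 0))
        analyticAt_const.meromorphicOrderAt_nonneg
    rw [pt_eq_zero_iff.2 hl, cls_apply_self]
    refine lt_of_lt_of_le ?_ (add_le_add_right hle _)
    exact_mod_cast (by norm_num : (0 : ℤ) < 3 * 1 + -2)
  · rw [cubicPoint, if_neg hl] at hz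
    rw [cls_apply_of_ne (fun h => hl (pt_eq_zero_iff.1 h.symm)), mul_zero, WithTop.coe_zero,
      zero_add, ← tendsto_zero_iff_meromorphicOrderAt_pos
        ((isRationalFunction_lineFunction h).1 z)]
    have hc : ContinuousAt (lineFunction L h) z := by
      have h1 := (L.analyticOnNhd_weierstrassP z hl).continuousAt
      have h2 := (L.analyticOnNhd_derivWeierstrassP z hl).continuousAt
      rw [funext (lineFunction_eq h)]
      fun_prop
    have := hc.tendsto.mono_left (nhdsWithin_le_nhds (s := {z}ᶜ))
    rwa [show lineFunction L h z = 0 from hz] at this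

end

/-! ### Functions of degree three as quotients of concurrent lines -/

variable {τ : ℂ} {hτ : τ.im ≠ 0}

/-- An elliptic function with at most a triple pole at the origin is a linear form in
`℘, ℘', 1`. -/
theorem exists_lineFunction_eq {f : ℂ → ℂ} {A : PointGroup (periods τ hτ)}
    (hf : IsRationalFunction (periods τ hτ) f) (hA : HasDivisor f A)
    (hle : 0 ≤ A + (3 : ℤ) • cls 0) :
    ∃ h : Fin 3 → ℂ, ∀ z, f =ᶠ[𝓝[≠] z] lineFunction (periods τ hτ) h := by
  have hP := isRationalFunction_weierstrassP (periods τ hτ)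
  have hP' := isRationalFunction_derivWeierstrassP (periods τ hτ)
  have h0 : (0 : ℂ) ∈ (periods τ hτ).lattice := zero_mem _
  -- Subtracting multiples of `℘'` and then of `℘` removes the poles of order three and two, leaving
  -- at most a simple pole at the origin.
  obtain ⟨c₁, hc₁⟩ := exists_lt_meromorphicOrderAt_sub (k := -3) (hf.1 0) (hP'.1 0) (by
    rw [hA 0, pt_eq_zero_iff.2 h0]
    have := hle 0
    simp at this
    have : -3 ≤ A 0 := by omega
    exact_mod_cast this) (order_derivWeierstrassP h0)
  have hf₁ := hf.sub ((IsRationalFunction.const (periods τ hτ) c₁).mul hP')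
  obtain ⟨c₂, hc₂⟩ := exists_lt_meromorphicOrderAt_sub (k := -2) (hf₁.1 0) (hP.1 0)
    (by exact_mod_cast hc₁)
    ((periods τ hτ).order_weierstrassP 0 h0)
  have hf₂ := hf₁.sub ((IsRationalFunction.const (periods τ hτ) c₂).mul hP)
  have hreg (z : ℂ) (hz : z ∉ (periods τ hτ).lattice) : 0 ≤ meromorphicOrderAt
      (fun z => f z - c₁ * (periods τ hτ).derivWeierstrassP z - c₂ * (periods τ hτ).weierstrassP z) z := by
    refine le_meromorphicOrderAt_sub (hf₁.1 z) ((MeromorphicAt.const _ _).mul (hP.1 z))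
      (le_meromorphicOrderAt_sub (hf.1 z) ((MeromorphicAt.const _ _).mul (hP'.1 z)) ?_
      (le_meromorphicOrderAt_const_mul _ (hP'.1 z) (order_derivWeierstrassP_nonneg hz)))
      (le_meromorphicOrderAt_const_mul _ (hP.1 z) (order_weierstrassP_nonneg hz))
    rw [hA z]
    have := hle (pt (periods τ hτ) z)
    rw [Finsupp.add_apply, Finsupp.smul_apply,
      cls_apply_of_ne (fun h => hz (pt_eq_zero_iff.1 h.symm))] at this
    simp at this
    exact_mod_cast this
  -- A point off the lattice, where subtracting a constant makes the remainder vanish.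
  have hz₁ := (periods τ hτ).ω₁_div_two_notMem_lattice
  set z₁ := (periods τ hτ).ω₁ / 2
  obtain ⟨c₃, hc₃⟩ := exists_lt_meromorphicOrderAt_sub (k := 0) (g := fun _ => (1 : ℂ)) (hf₂.1 z₁)
    (.const 1 z₁) (hreg z₁ hz₁) (by
      classical
      rw [meromorphicOrderAt_const, if_neg one_ne_zero]; rfl)
  have hf₃ := hf₂.sub ((IsRationalFunction.const (periods τ hτ) c₃).mul (.const (periods τ hτ) 1))
  by_cases htop : ∃ z, meromorphicOrderAt (fun z => f z - c₁ * (periods τ hτ).derivWeierstrassP z -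
      c₂ * (periods τ hτ).weierstrassP z - c₃ * 1) z ≠ ⊤
  · exfalso
    obtain ⟨z, hz⟩ := htop
    obtain ⟨D, hD⟩ := hf₃.exists_hasDivisor hz
    have hdeg := hD.degree_and_pointSum hf₃
    have hD0 (k : ℤ) (hk : k ≤ 0) (z : ℂ) (h : (k : WithTop ℤ) ≤ meromorphicOrderAt
        (fun z => f z - c₁ * (periods τ hτ).derivWeierstrassP z - c₂ * (periods τ hτ).weierstrassP z) z) : k ≤ D (pt (periods τ hτ) z) := by
      have h1 := le_meromorphicOrderAt_sub (hf₂.1 z)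
        (((IsRationalFunction.const (periods τ hτ) c₃).mul (.const (periods τ hτ) 1)).1 z) h
        (le_meromorphicOrderAt_const_mul c₃ (.const 1 z) (le_trans (by exact_mod_cast hk)
          analyticAt_const.meromorphicOrderAt_nonneg))
      rw [hD z] at h1
      exact_mod_cast h1
    have hne : pt (periods τ hτ) z₁ ≠ 0 := fun h => hz₁ (pt_eq_zero_iff.1 h)
    have hDle : cls (pt (periods τ hτ) z₁) - cls 0 ≤ D := fun x => by
      obtain ⟨z, rfl⟩ := pt_surjective x
      by_cases hz : z ∈ (periods τ hτ).lattice
      · rw [pt_eq_zero_iff.2 hz, Finsupp.sub_apply, cls_apply_of_ne hne, cls_apply_self]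
        have := hD0 (-1) (by norm_num) 0 (by exact_mod_cast hc₂)
        rwa [pt_eq_zero_iff.2 h0] at this
      · rw [Finsupp.sub_apply, cls_apply_of_ne (fun h => hz (pt_eq_zero_iff.1 h.symm))]
        by_cases hzz : pt (periods τ hτ) z₁ = pt (periods τ hτ) z
        · rw [← hzz, cls_apply_self]
          rw [hD z₁] at hc₃
          have : 0 + 1 ≤ D (pt (periods τ hτ) z₁) := by exact_mod_cast hc₃
          simpa using this
        · rw [cls_apply_of_ne hzz]
          exact hD0 0 le_rfl z (hreg z hz)
    -- A divisor of degree zero that is at least `[z₁] - [0]` equals it, but its sum `z₁` is not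
    -- zero on `E`. The remainder is thus identically zero.
    have hzero := eq_zero_of_degree_eq_zero (sub_nonneg.2 hDle) (by simp [hdeg.1])
    have := congrArg pointSum hzero
    simp [hdeg.2, hne] at this
  · push Not at htop
    refine ⟨![c₂, c₁, c₃], fun z => ?_⟩
    filter_upwards [meromorphicOrderAt_eq_top_iff.1 (htop z)] with w hw
    rw [lineFunction_eq]
    simp
    linear_combination hw

/-- Proportional forms have the same multiplicities, yet at `p 0` the first vanishes and the second
does not. The zero form is excluded because its order is `⊤`. -/
theorem linearIndependent_of_isLineSection {L : PeriodPair} {h h' : Fin 3 → ℂ}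
    {p p' : Fin 3 → Curve L} (hp : IsLineSection h p) (hp' : IsLineSection h' p')
    (hne : ∀ i j, p i ≠ p' j) : LinearIndependent ℂ ![h, h'] := by
  have hsmul (c : ℂ) (h : Fin 3 → ℂ) (w z : ℂ) :
      (c • h) ⬝ᵥ cubicLift L z w = c * (h ⬝ᵥ cubicLift L z w) := by
    rw [smul_dotProduct, smul_eq_mul]
  obtain ⟨z, hz⟩ := pt_surjective (p 0)
  have hpos : 0 < (∑ i, cls (p i)) (p 0) := by
    rw [← cls_le_iff (sum_cls_nonneg _ _)]
    exact Finset.single_le_sum (f := fun i => cls (p i)) (fun i _ => cls_nonneg _)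
      (Finset.mem_univ 0)
  have hzero : (∑ i, cls (p' i)) (p 0) = 0 := by
    rw [Finsupp.finsetSum_apply]
    exact Finset.sum_eq_zero fun i _ => cls_apply_of_ne (hne 0 i).symm
  have h1 := hp z
  have h2 := hp' z
  rw [hz] at h1 h2
  rw [hzero] at h2
  have hh' : h' ≠ 0 := by
    rintro rfl
    rw [lineMultiplicity] at h2
    simp only [zero_dotProduct] at h2
    rw [meromorphicOrderAt_eq_top_iff.2 (Eventually.of_forall fun _ => rfl)] at h2
    exact WithTop.top_ne_coe h2
  have hh : h ≠ 0 := by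
    rintro rfl
    rw [lineMultiplicity] at h1
    simp only [zero_dotProduct] at h1
    rw [meromorphicOrderAt_eq_top_iff.2 (Eventually.of_forall fun _ => rfl)] at h1
    exact WithTop.top_ne_coe h1
  rw [LinearIndependent.pair_iff' hh]
  rintro c rfl
  have hc : c ≠ 0 := by
    rintro rfl
    exact hh' (zero_smul _ _)
  rw [lineMultiplicity] at h1 h2
  simp only [hsmul] at h2
  have hmer := meromorphicAt_of_meromorphicOrderAt_ne_zero (h1.trans_ne fun h0 =>
    hpos.ne' (by exact_mod_cast h0))
  rw [fun_meromorphicOrderAt_mul (.const c z) hmer, h1, meromorphicOrderAt_const, if_neg hc,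
    zero_add] at h2
  exact hpos.ne' (by exact_mod_cast h2)

/-- The zeros, poles and `1`-points of an elliptic function of degree three whose poles have sum
zero are sections of the cubic by three concurrent lines. -/
theorem isConcurrentSection_of_hasDivisor {f : ℂ → ℂ} {α β γ : Fin 3 → Curve (periods τ hτ)}
    (hf : IsRationalFunction (periods τ hτ) f)
    (hA : HasDivisor f (∑ i, cls (α i) - ∑ i, cls (γ i)))
    (hB : HasDivisor (fun z => 1 - f z) (∑ i, cls (β i) - ∑ i, cls (γ i)))
    (hαβ : ∀ i j, α i ≠ β j) (hβγ : ∀ i j, β i ≠ γ j) (hγα : ∀ i j, γ i ≠ α j)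
    (hsum : ∑ i, γ i = 0) : IsConcurrentSection α β γ := by
  -- `F` is the equation of the line through the poles of `f`. Then `F`, `f F` and `(1 - f) F` have
  -- at most a triple pole at the origin, so they are linear forms, and the last is the difference
  -- of the first two.
  obtain ⟨F, hF, hFd⟩ := exists_hasDivisor_of_pointSum_eq_zero
    (D := ∑ i, cls (γ i) - (3 : ℤ) • cls 0) (by simp [map_sum]) (by simp [map_sum, hsum])
  have hfF := hA.mul hf hF hFd
  rw [sub_add_sub_cancel] at hfF
  have heff (p : Fin 3 → Curve (periods τ hτ)) :
      0 ≤ ∑ i, cls (p i) - (3 : ℤ) • cls 0 + (3 : ℤ) • cls 0 := by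
    rw [sub_add_cancel]
    exact sum_cls_nonneg _ _
  obtain ⟨hm, hmF⟩ := exists_lineFunction_eq hF hFd (heff _)
  obtain ⟨hl, hlF⟩ := exists_lineFunction_eq (hf.mul hF) hfF (heff _)
  have hnF (z : ℂ) : (fun z => (1 - f z) * F z) =ᶠ[𝓝[≠] z]
      lineFunction (periods τ hτ) (hm - hl) := by
    filter_upwards [hmF z, hlF z] with w h1 h2
    rw [lineFunction, sub_dotProduct, ← lineFunction, ← lineFunction, ← h1, ← h2]
    ring
  have hnd := hB.mul hf.one_sub hF hFd
  rw [sub_add_sub_cancel] at hnd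
  have sl : IsLineSection hl α := isLineSection_of_hasDivisor (hfF.congr hlF)
  have sm : IsLineSection hm γ := isLineSection_of_hasDivisor (hFd.congr hmF)
  have sn : IsLineSection (hm - hl) β := isLineSection_of_hasDivisor (hnd.congr hnF)
  have ilm := linearIndependent_of_isLineSection sl sm fun i j => (hγα j i).symm
  -- The cross product of the two equations is the common point of the lines.
  have hcross : crossProduct hl hm ≠ 0 := crossProduct_ne_zero_iff_linearIndependent.2 ilm
  refine ⟨hl, hm, hm - hl, ⟨ilm, linearIndependent_of_isLineSection sm sn fun i j => (hβγ j i).symm,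
    linearIndependent_of_isLineSection sl sn hαβ⟩, by abel, ⟨crossProduct hl hm, hcross,
    dot_self_cross _ _, dot_cross_self _ _, ?_, fun z c hzc => ?_⟩, sl, sn, sm⟩
  · rw [sub_dotProduct, dot_self_cross, dot_cross_self, sub_zero]
  · have hc : c ≠ 0 := by
      rintro rfl
      exact hcross (by rw [hzc, zero_smul])
    -- If that point lay on the cubic it would belong to the sections by `hl` and by `hm`, giving
    -- `f` a common zero and pole.
    have key (h : Fin 3 → ℂ) (p : Fin 3 → Curve (periods τ hτ)) (hs : IsLineSection h p)
        (h0 : h ⬝ᵥ crossProduct hl hm = 0) : ∃ i, p i = pt _ z := by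
      rw [hzc, dotProduct_smul, smul_eq_mul, mul_eq_zero, or_iff_right hc] at h0
      have hpos := lineMultiplicity_pos h0
      rw [hs z] at hpos
      by_contra hcon
      push Not at hcon
      rw [Finsupp.finsetSum_apply, Finset.sum_eq_zero fun i _ => cls_apply_of_ne (hcon i)] at hpos
      exact lt_irrefl _ hpos
    obtain ⟨i, hi⟩ := key hl α sl (dot_self_cross _ _)
    obtain ⟨j, hj⟩ := key hm γ sm (dot_cross_self _ _)
    exact hγα j i (hj.trans hi.symm)

theorem cls_add_apply {L : PeriodPair} (a x t : Curve L) : cls a (x + t) = cls (a - t) x := by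
  classical
  simp only [cls, Finsupp.single_apply, sub_eq_iff_eq_add]

theorem ne_of_disjoint {L : PeriodPair} {n : ℕ} {p q : Fin n → Curve L}
    (h : ∀ x, (∑ i, cls (p i)) x = 0 ∨ (∑ i, cls (q i)) x = 0) (i j : Fin n) : p i ≠ q j := by
  intro hij
  have hpos (z : Fin n → Curve L) (k : Fin n) : 0 < (∑ i, cls (z i)) (z k) := by
    rw [← cls_le_iff (sum_cls_nonneg _ _)]
    exact Finset.single_le_sum (f := fun i => cls (z i)) (fun i _ => cls_nonneg _)
      (Finset.mem_univ k)
  have h1 := hpos p i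
  have h2 := hpos q j
  rw [← hij] at h2
  have := h (p i)
  omega

/-- The relation involves only differences of points, hence is invariant under translation.
Translating by a third of the sum of the poles makes that sum zero. -/
theorem relationsVanish_three : RelationsVanish (periods τ hτ) 3 := by
  intro f P Q R hT
  obtain ⟨α, rfl⟩ := exists_eq_sum_cls hT.nonneg₀ hT.degree₀
  obtain ⟨β, rfl⟩ := exists_eq_sum_cls hT.nonneg₁ hT.degree₁
  obtain ⟨γ, rfl⟩ := exists_eq_sum_cls hT.nonneg_top hT.degree_top
  obtain ⟨s, hs⟩ := pt_surjective (∑ i, γ i)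
  set t : Curve (periods τ hτ) := pt _ (s / 3) with ht
  have ht3 : (3 : ℤ) • t = ∑ i, γ i := by
    rw [ht, ← pt_zsmul, ← hs]
    congr 1
    push_cast
    ring
  have htrans {g : ℂ → ℂ} {p q : Fin 3 → Curve (periods τ hτ)}
      (hg : HasDivisor g (∑ i, cls (p i) - ∑ i, cls (q i))) :
      HasDivisor (fun z => g (z + s / 3)) (∑ i, cls (p i - t) - ∑ i, cls (q i - t)) := fun z => by
    rw [meromorphicOrderAt_fun_comp_add_const_eq_meromorphicOrderAt, hg, pt_add]
    simp only [Finsupp.sub_apply, Finsupp.finsetSum_apply, cls_add_apply, ← ht]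
  have hne {p q : Fin 3 → Curve (periods τ hτ)} (h : ∀ i j, p i ≠ q j) (i j : Fin 3) :
      p i - t ≠ q j - t := fun h' => h i j (sub_left_injective h')
  have hαβ := hne (ne_of_disjoint hT.disjoint₀₁)
  have hβγ := hne (ne_of_disjoint hT.disjoint₁_top)
  have hγα := hne (ne_of_disjoint hT.disjoint_top₀)
  have hconc := isConcurrentSection_of_hasDivisor (hT.rational.comp_add (s / 3))
    (htrans hT.divisor₀) (htrans hT.divisor₁) hαβ hβγ hγα
    (by rw [Finset.sum_sub_distrib, ← ht3, Finset.sum_const, Finset.card_univ, Fintype.card_fin,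
      ← natCast_zsmul]; exact sub_self _)
  have hrel : blochRel (fun i => α i - t) (fun i => β i - t) (fun i => γ i - t) =
      blochRel α β γ := by
    simp only [blochRel, sub_sub_sub_cancel_right]
  rw [← blochRel_eq_cyclicPairing, ← hrel]
  exact relations_le (Submodule.mem_sup_right (Submodule.subset_span
    ⟨_, _, _, hconc, fun i j => ⟨hαβ i j, hβγ i j, hγα i j⟩, rfl⟩))

end

section

variable {L : PeriodPair}

/-! ### The coefficient of the origin -/

theorem blochRel_apply_zero {n : ℕ} {α β γ : Fin n → Curve L}
    (h : ∀ i j, α i ≠ β j ∧ β i ≠ γ j ∧ γ i ≠ α j) : blochRel α β γ 0 = 0 := by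
  rw [blochRel, Finsupp.finsetSum_apply]
  refine Finset.sum_eq_zero fun i _ => ?_
  rw [Finsupp.finsetSum_apply]
  refine Finset.sum_eq_zero fun j _ => ?_
  obtain ⟨h1, h2, h3⟩ := h i j
  rw [Finsupp.add_apply, Finsupp.add_apply, cls_apply_of_ne (sub_ne_zero.2 h1),
    cls_apply_of_ne (sub_ne_zero.2 h2), cls_apply_of_ne (sub_ne_zero.2 h3)]
  simp

/-- An antisymmetry relation contributes `2` or `0` at the origin, and disjoint sections contribute
`0`. This is why `concurrentRels` requires disjointness. -/
theorem even_apply_zero {x : PointGroup L} (hx : x ∈ relations L) : Even (x 0) := by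
  have hle : relations L ≤
      (Submodule.span ℤ {(2 : ℤ)}).comap (Finsupp.lapply (0 : Curve L) : PointGroup L →ₗ[ℤ] ℤ) := by
    refine sup_le (Submodule.span_le.2 ?_) (Submodule.span_le.2 ?_)
    · rintro _ ⟨ξ, rfl⟩
      rw [SetLike.mem_coe, Submodule.mem_comap, Finsupp.lapply_apply, antisymmetryRel,
        Finsupp.add_apply]
      by_cases h : ξ = 0
      · subst h
        rw [neg_zero, cls_apply_self]
        exact Submodule.subset_span rfl
      · rw [cls_apply_of_ne h, cls_apply_of_ne (neg_ne_zero.2 h)]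
        exact zero_mem _
    · rintro _ ⟨α, β, γ, -, h, rfl⟩
      rw [SetLike.mem_coe, Submodule.mem_comap, Finsupp.lapply_apply, blochRel_apply_zero h]
      exact zero_mem _
  obtain ⟨k, hk⟩ := Submodule.mem_span_singleton.1 (hle hx)
  exact ⟨k, by rw [Finsupp.lapply_apply, smul_eq_mul] at hk; omega⟩

/-- The multiple of `[0]` has to be even to cancel the coefficient of the rest, and `2[0]` is the
antisymmetry relation of the origin. -/
theorem mem_relations_of_apply_zero {x : PointGroup L} (hx : x ∈ relationsOrigin L)
    (h0 : x 0 = 0) : x ∈ relations L := by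
  obtain ⟨m, hm, y, hy, rfl⟩ := Submodule.mem_sup.1 hx
  obtain ⟨k, rfl⟩ := Submodule.mem_span_singleton.1 hy
  obtain ⟨c, hc⟩ := even_apply_zero hm
  rw [Finsupp.add_apply, Finsupp.smul_apply, cls_apply_self, smul_eq_mul, mul_one] at h0
  obtain rfl : k = -c + -c := by omega
  have := Submodule.smul_mem _ (-c) (antisymmetryRel_mem (0 : Curve L))
  rw [antisymmetryRel, neg_zero, smul_add, ← add_smul] at this
  exact add_mem hm this

theorem exists_eq_sum_of_mem_relations {x : PointGroup L} (hx : x ∈ relations L) :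
    ∃ (r s : ℕ) (a : Fin r → ℤ) (ξ : Fin r → Curve L) (b : Fin s → ℤ)
      (A B C : Fin s → Fin 3 → Curve L), (∀ k, IsConcurrentSection (A k) (B k) (C k)) ∧
      x = ∑ k, a k • antisymmetryRel (ξ k) + ∑ k, b k • blochRel (A k) (B k) (C k) := by
  obtain ⟨y, hy, z, hz, rfl⟩ := Submodule.mem_sup.1 hx
  obtain ⟨r, a, u, rfl⟩ := Submodule.mem_span_set'.1 hy
  obtain ⟨s, b, v, rfl⟩ := Submodule.mem_span_set'.1 hz
  choose ξ hξ using fun k => (u k).2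
  choose A B C hABC using fun k => (v k).2
  refine ⟨r, s, a, ξ, b, A, B, C, fun k => (hABC k).1, ?_⟩
  simp only [hξ, ← (hABC _).2.2]

/-! ### From formal relations to values of the elliptic dilogarithm -/

variable {τ : ℂ} {hτ : τ.im ≠ 0}

/-- The number of listed zeros equals the degree, so nothing cancels between the `α i` and the `γ
i`, and the fibres are disjoint. -/
theorem IsFibreTriple.of_hasDegree {f : ℂ → ℂ} {n : ℕ} {α β γ : Fin n → Curve (periods τ hτ)}
    (hf : IsRationalFunction (periods τ hτ) f) (hn : HasDegree (periods τ hτ) f n)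
    (hA : HasDivisor f (∑ i, (cls (α i) - cls (γ i))))
    (hB : HasDivisor (fun z => 1 - f z) (∑ i, (cls (β i) - cls (γ i)))) :
    IsFibreTriple f (∑ i, cls (α i)) (∑ i, cls (β i)) (∑ i, cls (γ i)) n := by
  rw [Finset.sum_sub_distrib] at hA hB
  obtain ⟨D, hD, hdeg⟩ := hn
  obtain rfl := hD.unique hA
  have hP := sum_cls_nonneg Finset.univ α
  have hR := sum_cls_nonneg Finset.univ γ
  have hPn : Finsupp.degree (∑ i, cls (α i)) = n := by simp [map_sum]
  have hle := posDivisor_le (sub_le_self (∑ i, cls (α i)) hR) hP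
  have heq := eq_zero_of_degree_eq_zero (sub_nonneg.2 hle)
    (by rw [map_sub, hPn, degree_posDivisor, hdeg, sub_self])
  have hdisj (x) : (∑ i, cls (γ i)) x = 0 ∨ (∑ i, cls (α i)) x = 0 := by
    have h := DFunLike.congr_fun heq x
    rw [Finsupp.sub_apply, posDivisor_apply, Finsupp.sub_apply, Finsupp.zero_apply] at h
    have h1 := hP x
    have h2 := hR x
    rw [Finsupp.zero_apply] at h1 h2
    omega
  have := isFibreTriple_of_hasDivisor hf hP hR hdisj hA hB hPn
  rwa [sub_add_cancel] at this

theorem blochRel_mem_relations {f : ℂ → ℂ} {n : ℕ} {α β γ : Fin n → Curve (periods τ hτ)}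
    (hT : IsFibreTriple f (∑ i, cls (α i)) (∑ i, cls (β i)) (∑ i, cls (γ i)) n) :
    blochRel α β γ ∈ relations (periods τ hτ) := by
  refine mem_relations_of_apply_zero ?_ (blochRel_apply_zero fun i j =>
    ⟨ne_of_disjoint hT.disjoint₀₁ i j, ne_of_disjoint hT.disjoint₁_top i j,
      ne_of_disjoint hT.disjoint_top₀ i j⟩)
  rw [blochRel_eq_cyclicPairing]
  exact relationsVanish_of_degree_three relationsVanish_three n f _ _ _ hT

/-- The additive extension of the elliptic dilogarithm to `ℤ[E]`. -/
def ellDilogHom (τ : ℂ) (hτ : τ.im ≠ 0) : PointGroup (periods τ hτ) →+ ℝ :=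
  Finsupp.liftAddHom fun p => zmultiplesHom ℝ (ellDilog τ hτ p)

theorem ellDilogHom_cls (p : Curve (periods τ hτ)) :
    ellDilogHom τ hτ (cls p) = ellDilog τ hτ p := by
  simp [ellDilogHom, cls]

theorem ellDilogHom_blochRel {n : ℕ} (α β γ : Fin n → Curve (periods τ hτ)) :
    ellDilogHom τ hτ (blochRel α β γ) = blochSum τ hτ α β γ := by
  simp only [blochRel, blochSum, map_sum, map_add, ellDilogHom_cls]

theorem ellDilogHom_antisymmetryRel (ξ : Curve (periods τ hτ)) :
    ellDilogHom τ hτ (antisymmetryRel ξ) = ellDilog τ hτ ξ + ellDilog τ hτ (-ξ) := by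
  simp only [antisymmetryRel, map_add, ellDilogHom_cls]

end

end EllipticDilog

end

/-- For every rational function `f` on `E = ℂ / ⟨1, τ⟩` the elliptic Bloch relation of `f` is an
integer linear combination of antisymmetry relations and of relations of concurrent lines, as a
formal combination of points of `E`, and hence between the values of `D_τ`. -/
theorem theorem1 (τ : ℂ) (hτ : τ.im ≠ 0) (f : ℂ → ℂ)
    (hf : EllipticDilog.IsRationalFunction (EllipticDilog.periods τ hτ) f)
    (n : ℕ) (hn : EllipticDilog.HasDegree (EllipticDilog.periods τ hτ) f n)
    (α β γ : Fin n → EllipticDilog.Curve (EllipticDilog.periods τ hτ))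
    (hdiv : EllipticDilog.HasDivisor f
      (∑ i, (EllipticDilog.cls (α i) - EllipticDilog.cls (γ i))))
    (hdiv' : EllipticDilog.HasDivisor (fun z => 1 - f z)
      (∑ i, (EllipticDilog.cls (β i) - EllipticDilog.cls (γ i)))) :
    ∃ (r s : ℕ) (a : Fin r → ℤ) (ξ : Fin r → EllipticDilog.Curve (EllipticDilog.periods τ hτ))
      (b : Fin s → ℤ)
      (A B C : Fin s → Fin 3 → EllipticDilog.Curve (EllipticDilog.periods τ hτ)),
      (∀ k, EllipticDilog.IsConcurrentSection (A k) (B k) (C k)) ∧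
      EllipticDilog.blochRel α β γ =
        ∑ k, a k • EllipticDilog.antisymmetryRel (ξ k) +
          ∑ k, b k • EllipticDilog.blochRel (A k) (B k) (C k) ∧
      EllipticDilog.blochSum τ hτ α β γ =
        ∑ k, (a k : ℝ) * (EllipticDilog.ellDilog τ hτ (ξ k) + EllipticDilog.ellDilog τ hτ (-ξ k)) +
          ∑ k, (b k : ℝ) * EllipticDilog.blochSum τ hτ (A k) (B k) (C k) := by
  obtain ⟨r, s, a, ξ, b, A, B, C, hABC, h⟩ := EllipticDilog.exists_eq_sum_of_mem_relations
    (EllipticDilog.blochRel_mem_relations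
      (EllipticDilog.IsFibreTriple.of_hasDegree hf hn hdiv hdiv'))
  refine ⟨r, s, a, ξ, b, A, B, C, hABC, h, ?_⟩
  -- The numerical identity is the image of the formal one under the additive extension of `D_τ`.
  rw [← EllipticDilog.ellDilogHom_blochRel, h]
  simp only [map_add, map_sum, map_zsmul, EllipticDilog.ellDilogHom_blochRel,
    EllipticDilog.ellDilogHom_antisymmetryRel, zsmul_eq_mul]
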